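/- Let $\mathbb R_+=(0,\infty)$ and $\mathbb N=\{1,2,\dots\}$. Let $\mu$ be a probability measure on $\mathbb R_+^{\mathbb N}\times\mathbb R_+^{\mathbb N}$, the distribution of a pair of random sequences $(\mathbf a,\mathbf b)=((a_i)_{i\in\mathbb N},(b_j)_{j\in\mathbb N})$. For $k\in\mathbb N$ let $\tau_k$ be the shift $(c_n)_n\mapsto(c_{n+k})_n$, and assume that for all $k,l\in\mathbb N$ the map $\tau_k\times\tau_l$ preserves $\mu$ and is ergodic (every Borel set $B$ with $(\tau_k\times\tau_l)^{-1}(B)=B$ has $\mu(B)\in\{0,1\}$). Assume further that $\mathbb E[a_1+b_1]<\infty$ and $\operatorname{ess\,inf} a_1+\operatorname{ess\,inf} b_1>0$, where $\mathbb E$ and $\operatorname{ess\,inf}$ refer to $\mu$. Given $(\mathbf a,\mathbf b)$, let $\mathbf P_{\mathbf a,\mathbf b}$ (the quenched measure) be the probability measure under which the weights $W(i,j)$, $i,j\in\mathbb N$, are independent and $W(i,j)$ is exponentially distributed with rate $a_i+b_j$, i.e. $\mathbf P_{\mathbf a,\mathbf b}(W(i,j)\ge x)=e^{-(a_i+b_j)x}$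 for $x\ge 0$. Define the last-passage times by $G(i,0)=G(0,j)=0$ and $G(i,j)=\max\{G(i-1,j),G(i,j-1)\}+W(i,j)$ for $i,j\in\mathbb N$. Let $g$ be the shape function of the model: for all $s,t>0$, $g(s,t)$ is the (existing, uniquely determined) deterministic real number such that, for $\mu$-almost every $(\mathbf a,\mathbf b)$, $n^{-1}G(\lfloor ns\rfloor,\lfloor nt\rfloor)\to g(s,t)$ as $n\to\infty$, $\mathbf P_{\mathbf a,\mathbf b}$-almost surely. Then, for $\mu$-almost every $(\mathbf a,\mathbf b)$, simultaneously for all $s,t>0$ and all real $r<g(s,t)$, $$\lim_{n\to\infty}-\frac1n\log \mathbf P_{\mathbf a,\mathbf b}\bigl(G(\lfloor ns\rfloor,\lfloor nt\rfloor)\le nr\bigr)=\infty,$$ with the convention $\log 0=-\infty$. -/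

import Mathlib

open MeasureTheory ProbabilityTheory Filter Topology

noncomputable section

namespace CornerGrowth

/-- Sequences with values in `(0, ∞)`. All sequences and arrays are indexed from `0`: the entry
with index `i` is the entry that is traditionally numbered `i + 1`. -/
abbrev PosSeq : Type := ℕ → Set.Ioi (0 : ℝ)

/-- The shift by `k`, sending `(c_n)` to `(c_{n+k})`. -/
def shift (k : ℕ) (c : PosSeq) : PosSeq := fun n => c (n + k)

instance instIsProbabilityMeasureExp (x y : Set.Ioi (0 : ℝ)) :
    IsProbabilityMeasure (expMeasure ((x : ℝ) + (y : ℝ))) :=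
  isProbabilityMeasure_expMeasure (add_pos x.2 y.2)

/-- The quenched measure for the parameters `p = (a, b)`: the law of an array of independent
weights whose `(i, j)` entry is exponentially distributed with rate `a i + b j`. -/
def quenched (p : PosSeq × PosSeq) : Measure (ℕ × ℕ → ℝ) :=
  Measure.infinitePi fun ij : ℕ × ℕ => expMeasure ((p.1 ij.1 : ℝ) + (p.2 ij.2 : ℝ))

/-- The last-passage times `G(m, n)` of the weights `w`: they vanish if `m = 0` or `n = 0`, and
`G(m, n) = max (G(m - 1, n)) (G(m, n - 1)) + W(m, n)` for `m, n ≥ 1`, where `W(m, n)` is the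
entry `w (m - 1, n - 1)` in the indexing from `0`. -/
def lastPassage (w : ℕ × ℕ → ℝ) : ℕ → ℕ → ℝ
  | 0, _ => 0
  | _ + 1, 0 => 0
  | m + 1, n + 1 => max (lastPassage w m (n + 1)) (lastPassage w (m + 1) n) + w (m, n)

/-- `g` is the shape function of the model with parameters drawn from `μ`: for all `s, t > 0`,
the deterministic number `g s t` is the almost sure limit of `G(⌊ns⌋, ⌊nt⌋) / n`. This determines
`g s t` uniquely for `s, t > 0` (when `μ` is a probability measure). -/
def IsShapeFunction (μ : Measure (PosSeq × PosSeq)) (g : ℝ → ℝ → ℝ) : Prop :=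
  ∀ s t : ℝ, 0 < s → 0 < t → ∀ᵐ p ∂μ, ∀ᵐ w ∂(quenched p),
    Tendsto (fun n : ℕ => lastPassage w ⌊(n : ℝ) * s⌋₊ ⌊(n : ℝ) * t⌋₊ / (n : ℝ)) atTop
      (𝓝 (g s t))

end CornerGrowth

end

/-! The event that `G` is small at speed `n` is costlier than any exponential, because many disjoint
parts of the environment must all be slow. Cut the quadrant into `k × l` blocks whose mean passage
time exceeds `q * r`. A chain of about `n / q` diagonal blocks bounds `G` from below by a sum of
independent passage times, and Chernoff's bound gives `exp (-δ n)`. For any fixed `L`, the same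
holds for `L` parallel chains, which use disjoint blocks: `passage_le_prob_le` multiplies their
bounds into `exp (-L δ n)` up to rounding, and `L` is arbitrary (`ae_exists_lower_tail_le`). The
quenched exponents are averages of `laplaceGap` along shifts of the parameters, controlled by the
ergodic theorem for `μ`.

The shape function is the supremum `shape` of normalized means. The case `L = 1` and Borel–Cantelli
give the lower bound for the limit (`ae_eventually_lt_passage`). The upper bound comes from a
superadditive ergodic argument on `μ.prod expArray` (`Superadditive.ae_eventually_lt`): as the lower
growth rate is already known to reach the mean rate, an excess on a set of positive measure would
make the mean too large. Thus ergodicity of the product system is never needed. -/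

namespace Superadditive

/-! ### Superadditive sequences over a measure-preserving map -/

variable {Ω : Type*} {T : Ω → Ω} {X : ℕ → Ω → ℝ}

/-- Greedy covering of `[0, n)` by intervals on which `X` is at least `v` times the length. -/
theorem mul_le_add_sum_indicator (h0 : ∀ n ω, 0 ≤ X n ω)
    (hs : ∀ m n ω, X m ω + X n (T^[m] ω) ≤ X (m + n) ω) {v : Ω → ℝ} {K : ℝ}
    (hv0 : ∀ ω, 0 ≤ v ω) (hvK : ∀ ω, v ω ≤ K) (M : ℕ) (B : Set Ω)
    (hB : ∀ ω ∈ B, ∃ j, 0 < j ∧ j ≤ M ∧ j * v ω ≤ X j ω) (n : ℕ) :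
    ∀ ω, (∀ k, v (T^[k] ω) = v ω) →
      n * v ω ≤ X n ω + M * K + ∑ k ∈ Finset.range n, Bᶜ.indicator (fun _ => K) (T^[k] ω) := by
  induction n using Nat.strong_induction_on with
  | _ n ih =>
  intro ω hω
  have hK : 0 ≤ K := (hv0 ω).trans (hvK ω)
  have hind : ∀ x, 0 ≤ Bᶜ.indicator (fun _ => K) x :=
    fun x => Set.indicator_nonneg (fun _ _ => hK) x
  -- One greedy step: split off a first interval of length `j` on which the estimate holds without
  -- the `M * K` term, so that this error is paid only once, at the end.
  have key : ∀ j, 0 < j → j ≤ n →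
      j * v ω ≤ X j ω + ∑ k ∈ Finset.range j, Bᶜ.indicator (fun _ => K) (T^[k] ω) →
      n * v ω ≤ X n ω + M * K + ∑ k ∈ Finset.range n, Bᶜ.indicator (fun _ => K) (T^[k] ω) := by
    intro j hj hjn h
    have h1 := ih (n - j) (by omega) (T^[j] ω) (fun k => by
      rw [← Function.iterate_add_apply, hω, hω])
    have h2 := hs j (n - j) ω
    rw [Nat.add_sub_cancel' hjn] at h2
    have h3 : ∑ k ∈ Finset.range n, Bᶜ.indicator (fun _ => K) (T^[k] ω)
        = ∑ k ∈ Finset.range j, Bᶜ.indicator (fun _ => K) (T^[k] ω)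
          + ∑ k ∈ Finset.range (n - j), Bᶜ.indicator (fun _ => K) (T^[k] (T^[j] ω)) := by
      conv_lhs => rw [← Nat.add_sub_cancel' hjn, Finset.sum_range_add]
      simp only [← Function.iterate_add_apply, add_comm]
    rw [hω, Nat.cast_sub hjn] at h1
    rw [h3]
    linarith
  -- A remainder of length at most `M` is paid for by `M * K`. Otherwise a point of `B` starts a
  -- good interval, and a point outside `B` is skipped at the price `K` recorded by the indicator.
  rcases le_or_gt n M with hn | hn
  · have h1 : (n : ℝ) * v ω ≤ M * K :=
      mul_le_mul (by exact_mod_cast hn) (hvK ω) (hv0 ω) (Nat.cast_nonneg _)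
    have h2 := Finset.sum_nonneg (s := Finset.range n) fun k _ => hind (T^[k] ω)
    linarith [h0 n ω]
  · by_cases hωB : ω ∈ B
    · obtain ⟨j, hj, hjM, hjX⟩ := hB ω hωB
      refine key j hj (by omega) ?_
      have h2 := Finset.sum_nonneg (s := Finset.range j) fun k _ => hind (T^[k] ω)
      linarith
    · refine key 1 one_pos (by omega) ?_
      simp [hωB]
      linarith [h0 1 ω, hvK ω]

/-- The points at which `X n / n` exceeds some number larger than `c` infinitely often. -/
def upperSet (X : ℕ → Ω → ℝ) (c : ℝ) : Set Ω :=
  {ω | ∃ m : ℕ, ∃ᶠ n : ℕ in atTop, n * (c + 1 / (m + 1 : ℝ)) ≤ X n ω}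

/-- Superadditivity and `X 1 ≥ 0` give `X (n + 1) ω ≥ X n (T ω)`. Passing from `m` to `m + 1` leaves
slack `d`, and `n * d` eventually absorbs the change of length from `n` to `n + 1`. -/
theorem preimage_upperSet_subset (h0 : ∀ n ω, 0 ≤ X n ω)
    (hs : ∀ m n ω, X m ω + X n (T^[m] ω) ≤ X (m + n) ω) (c : ℝ) :
    T ⁻¹' upperSet X c ⊆ upperSet X c := by
  rintro ω ⟨m, hm⟩
  refine ⟨m + 1, ?_⟩
  set d : ℝ := 1 / (m + 1 : ℝ) - 1 / ((m + 1 : ℕ) + 1 : ℝ) with hd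
  have hdpos : 0 < d := by
    rw [hd, sub_pos]
    exact one_div_lt_one_div_of_lt (by positivity) (by push_cast; linarith)
  have hev : ∀ᶠ n : ℕ in atTop, c + 1 / ((m + 1 : ℕ) + 1 : ℝ) ≤ n * d :=
    ((tendsto_natCast_atTop_atTop (R := ℝ)).atTop_mul_const hdpos).eventually_ge_atTop _
  have h1 : ∃ᶠ n : ℕ in atTop,
      ((n + 1 : ℕ) : ℝ) * (c + 1 / ((m + 1 : ℕ) + 1 : ℝ)) ≤ X (n + 1) ω := by
    refine (hm.and_eventually hev).mono ?_
    rintro n ⟨h2, h3⟩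
    have h4 := hs 1 n ω
    rw [add_comm 1 n] at h4
    have h5 := h0 1 ω
    have h6 : (c + 1 / (m + 1 : ℝ)) = (c + 1 / ((m + 1 : ℕ) + 1 : ℝ)) + d := by rw [hd]; ring
    rw [h6] at h2
    simp only [Function.iterate_one] at h4
    push_cast at h2 h3 ⊢
    nlinarith
  exact (tendsto_add_atTop_nat 1).frequently h1

theorem exists_mul_le_of_mem_upperSet {c : ℝ} {ω : Ω} (h : ω ∈ upperSet X c) :
    ∃ n : ℕ, 0 < n ∧ n * c ≤ X n ω := by
  obtain ⟨m, hm⟩ := h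
  obtain ⟨n, h1, h2⟩ := (hm.and_eventually (eventually_gt_atTop 0)).exists
  refine ⟨n, h2, le_trans ?_ h1⟩
  have : (0 : ℝ) ≤ 1 / (m + 1 : ℝ) := by positivity
  exact mul_le_mul_of_nonneg_left (by linarith) (Nat.cast_nonneg _)

theorem eventually_lt_of_notMem_upperSet {c c' : ℝ} (hc : c < c') {ω : Ω}
    (h : ω ∉ upperSet X c) : ∀ᶠ n : ℕ in atTop, X n ω < n * c' := by
  obtain ⟨m, hm⟩ := exists_nat_one_div_lt (sub_pos.2 hc)
  have h1 : ¬ ∃ᶠ n : ℕ in atTop, n * (c + 1 / (m + 1 : ℝ)) ≤ X n ω := fun h' => h ⟨m, h'⟩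
  rw [not_frequently] at h1
  filter_upwards [h1] with n hn
  refine (not_le.1 hn).trans_le ?_
  exact mul_le_mul_of_nonneg_left (by linarith) (Nat.cast_nonneg _)

variable [MeasurableSpace Ω] {P : Measure Ω}

/-- If `v` is invariant and every point has some `n ≥ 1` with `X n ≥ n v`, then the mean of `v`
is at most the growth rate of the means of the superadditive sequence `X`. -/
theorem integral_le_of_exists_mul_le [IsProbabilityMeasure P] (hT : MeasurePreserving T P P)
    (hX : ∀ n, Measurable (X n)) (hXi : ∀ n, Integrable (X n) P) (h0 : ∀ n ω, 0 ≤ X n ω)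
    (hs : ∀ m n ω, X m ω + X n (T^[m] ω) ≤ X (m + n) ω) {Γ : ℝ}
    (hΓ : ∀ n, ∫ ω, X n ω ∂P ≤ n * Γ) {v : Ω → ℝ} {K : ℝ} (hv : Measurable v)
    (hv0 : ∀ ω, 0 ≤ v ω) (hvK : ∀ ω, v ω ≤ K) (hvT : ∀ᵐ ω ∂P, v (T ω) = v ω)
    (hvX : ∀ᵐ ω ∂P, ∃ n : ℕ, 0 < n ∧ n * v ω ≤ X n ω) :
    ∫ ω, v ω ∂P ≤ Γ := by
  set B : ℕ → Set Ω := fun M => {ω | ∃ j, 0 < j ∧ j ≤ M ∧ j * v ω ≤ X j ω} with hBdef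
  have hBm : ∀ M, MeasurableSet (B M) := by
    intro M
    have : B M = ⋃ j : ℕ, ⋃ (_ : 0 < j ∧ j ≤ M), {ω | j * v ω ≤ X j ω} := by
      ext ω; simp [hBdef, and_assoc]
    rw [this]
    exact MeasurableSet.iUnion fun j => MeasurableSet.iUnion fun _ =>
      measurableSet_le (hv.const_mul _) (hX j)
  have hvi : Integrable v P := Integrable.of_bound hv.aestronglyMeasurable K
    (Eventually.of_forall fun ω => by rw [Real.norm_of_nonneg (hv0 ω)]; exact hvK ω)
  have hinv : ∀ᵐ ω ∂P, ∀ k, v (T^[k] ω) = v ω := by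
    rw [ae_all_iff]
    intro k
    induction k with
    | zero => simp
    | succ k ih =>
      filter_upwards [ih, (hT.iterate k).quasiMeasurePreserving.ae hvT] with ω h1 h2
      rw [Function.iterate_succ_apply', h2, h1]
  have hindm : ∀ M, Measurable ((B M)ᶜ.indicator (fun _ : Ω => K)) := fun M =>
    measurable_const.indicator (hBm M).compl
  have hindi : ∀ M k, Integrable (fun ω => (B M)ᶜ.indicator (fun _ : Ω => K) (T^[k] ω)) P := by
    intro M k
    exact (hT.iterate k).integrable_comp_of_integrable
      ((integrable_const K).indicator (hBm M).compl)
  have hindI : ∀ M k, ∫ ω, (B M)ᶜ.indicator (fun _ : Ω => K) (T^[k] ω) ∂P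
      = P.real (B M)ᶜ * K := by
    intro M k
    rw [← integral_map (hT.iterate k).measurable.aemeasurable
      (f := (B M)ᶜ.indicator (fun _ : Ω => K)) (hindm M).aestronglyMeasurable,
      (hT.iterate k).map_eq, integral_indicator (hBm M).compl]
    simp
  have step : ∀ M n : ℕ, n * ∫ ω, v ω ∂P ≤ n * Γ + M * K + n * (P.real (B M)ᶜ * K) := by
    intro M n
    have h1 : ∫ ω, n * v ω ∂P ≤ ∫ ω, (X n ω + M * K
        + ∑ k ∈ Finset.range n, (B M)ᶜ.indicator (fun _ => K) (T^[k] ω)) ∂P := by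
      refine integral_mono_ae (hvi.const_mul _)
        (((hXi n).add (integrable_const _)).add (integrable_finsetSum _ fun k _ => hindi M k)) ?_
      filter_upwards [hinv] with ω hω
      exact mul_le_add_sum_indicator h0 hs hv0 hvK M (B M) (fun ω h => h) n ω hω
    have hXc : Integrable (fun ω => X n ω + M * K) P := (hXi n).add (integrable_const _)
    rw [integral_const_mul, integral_add hXc (integrable_finsetSum _ fun k _ => hindi M k),
      integral_add (hXi n) (integrable_const _), integral_finsetSum _ fun k _ => hindi M k] at h1
    simp only [hindI] at h1
    simp at h1
    linarith [hΓ n]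
  -- Divide by `n` and let `n → ∞` with `M` fixed; then `M → ∞`, where `B M` increases to a set of
  -- full measure by `hvX`.
  have step2 : ∀ M : ℕ, ∫ ω, v ω ∂P ≤ Γ + P.real (B M)ᶜ * K := by
    intro M
    have h1 : Tendsto (fun n : ℕ => Γ + M * K * (1 / (n : ℝ)) + P.real (B M)ᶜ * K) atTop
        (𝓝 (Γ + M * K * 0 + P.real (B M)ᶜ * K)) :=
      ((tendsto_one_div_atTop_nhds_zero_nat.const_mul _).const_add _).add_const _
    rw [mul_zero, add_zero] at h1
    refine ge_of_tendsto h1 ?_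
    filter_upwards [eventually_gt_atTop 0] with n hn
    have hn' : (0 : ℝ) < n := by exact_mod_cast hn
    have := step M n
    rw [← mul_le_mul_iff_right₀ hn']
    have e : (n : ℝ) * (M * K * (1 / n)) = M * K := by field_simp
    rw [mul_add, mul_add, e]
    exact this
  have hlim : Tendsto (fun M => P.real (B M)ᶜ) atTop (𝓝 0) := by
    have hanti : Antitone fun M => (B M)ᶜ := by
      intro M M' h
      refine Set.compl_subset_compl.2 ?_
      rintro ω ⟨j, h1, h2, h3⟩
      exact ⟨j, h1, h2.trans h, h3⟩
    have h1 := tendsto_measure_iInter_atTop (μ := P) (s := fun M => (B M)ᶜ)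
      (fun M => (hBm M).compl.nullMeasurableSet) hanti ⟨0, measure_ne_top _ _⟩
    have h2 : P (⋂ M, (B M)ᶜ) = 0 := by
      have h4 : ∀ᵐ ω ∂P, ω ∉ ⋂ M, (B M)ᶜ := by
        filter_upwards [hvX] with ω ⟨n, hn, h⟩ h3
        exact (Set.mem_iInter.1 h3 n) ⟨n, hn, le_rfl, h⟩
      exact measure_eq_zero_iff_ae_notMem.2 h4
    rw [h2] at h1
    have := (ENNReal.tendsto_toReal ENNReal.zero_ne_top).comp h1
    rw [ENNReal.toReal_zero] at this
    exact this
  have h3 : Tendsto (fun M => Γ + P.real (B M)ᶜ * K) atTop (𝓝 (Γ + 0 * K)) :=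
    (hlim.mul_const _).const_add _
  simpa using ge_of_tendsto' h3 step2

theorem measurableSet_upperSet (hX : ∀ n, Measurable (X n)) (c : ℝ) :
    MeasurableSet (upperSet X c) := by
  have : upperSet X c = ⋃ m : ℕ, limsup (fun n : ℕ => {ω | n * (c + 1 / (m + 1 : ℝ)) ≤ X n ω})
      atTop := by
    ext ω
    simp [upperSet, mem_limsup_iff_frequently_mem]
  rw [this]
  exact MeasurableSet.iUnion fun m => MeasurableSet.measurableSet_limsup fun n =>
    measurableSet_le measurable_const (hX n)

/-- One inclusion is pointwise, and the two sets have the same finite measure. -/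
theorem ae_upperSet_iff [IsFiniteMeasure P] (hT : MeasurePreserving T P P)
    (hX : ∀ n, Measurable (X n)) (h0 : ∀ n ω, 0 ≤ X n ω)
    (hs : ∀ m n ω, X m ω + X n (T^[m] ω) ≤ X (m + n) ω) (c : ℝ) :
    T ⁻¹' upperSet X c =ᵐ[P] upperSet X c :=
  ae_eq_of_subset_of_measure_ge (preimage_upperSet_subset h0 hs c)
    (hT.measure_preimage (measurableSet_upperSet hX c).nullMeasurableSet).ge
    (hT.measurable (measurableSet_upperSet hX c)).nullMeasurableSet (measure_ne_top _ _)

/-- For a nonnegative superadditive sequence, almost surely the upper growth rate is at most the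
growth rate of the means if the lower growth rate is at least that. -/
theorem ae_eventually_lt [IsProbabilityMeasure P] (hT : MeasurePreserving T P P)
    (hX : ∀ n, Measurable (X n)) (hXi : ∀ n, Integrable (X n) P) (h0 : ∀ n ω, 0 ≤ X n ω)
    (hs : ∀ m n ω, X m ω + X n (T^[m] ω) ≤ X (m + n) ω) {Γ : ℝ} (hΓ0 : 0 ≤ Γ)
    (hΓ : ∀ n, ∫ ω, X n ω ∂P ≤ n * Γ)
    (hlow : ∀ c < Γ, ∀ᵐ ω ∂P, ∃ n : ℕ, 0 < n ∧ n * c ≤ X n ω) {c' : ℝ} (hc' : Γ < c') :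
    ∀ᵐ ω ∂P, ∀ᶠ n : ℕ in atTop, X n ω < n * c' := by
  obtain ⟨c, hc, hcc'⟩ := exists_between hc'
  set A := upperSet X c with hA
  have hAm : MeasurableSet A := measurableSet_upperSet hX c
  have hAT : T ⁻¹' A =ᵐ[P] A := ae_upperSet_iff hT hX h0 hs c
  -- Apply the mean bound to the invariant function equal to `c > Γ` on `A` and `c₁` off `A`.
  -- Letting `c₁` approach `Γ` forces `P A = 0`.
  have key : ∀ c₁ : ℝ, 0 ≤ c₁ → (∀ᵐ ω ∂P, ∃ n : ℕ, 0 < n ∧ n * c₁ ≤ X n ω) →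
      P.real A * c + (1 - P.real A) * c₁ ≤ Γ := by
    intro c₁ hc₁ h
    classical
    have h1 := integral_le_of_exists_mul_le hT hX hXi h0 hs hΓ
      (v := A.piecewise (fun _ => c) (fun _ => c₁)) (K := max c c₁)
      (measurable_const.piecewise hAm measurable_const)
      (fun ω => by by_cases hω : ω ∈ A <;> simp [hω] <;> linarith)
      (fun ω => by by_cases hω : ω ∈ A <;> simp [hω])
      (by
        filter_upwards [hAT.mem_iff] with ω hω
        rw [Set.mem_preimage] at hω
        by_cases h2 : ω ∈ A
        · simp [h2, hω.2 h2]
        · have h3 : T ω ∉ A := fun h3 => h2 (hω.1 h3)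
          simp [h2, h3])
      (by
        filter_upwards [h] with ω hω
        by_cases h2 : ω ∈ A
        · simpa [h2] using exists_mul_le_of_mem_upperSet h2
        · simpa [h2] using hω)
    rw [integral_piecewise hAm integrableOn_const integrableOn_const] at h1
    simp only [setIntegral_const, smul_eq_mul, measureReal_compl hAm, probReal_univ] at h1
    exact h1
  have hP : P.real A = 0 := by
    have hP0 : 0 ≤ P.real A := measureReal_nonneg
    have hP1 : P.real A ≤ 1 := measureReal_le_one
    have h2 : P.real A * c + (1 - P.real A) * Γ ≤ Γ := by
      -- If `Γ = 0`, `hlow` offers only negative rates, but `c₁ = 0` is admissible by nonnegativity.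
      rcases hΓ0.eq_or_lt with h | h
      · have := key 0 le_rfl (Eventually.of_forall fun ω => ⟨1, one_pos, by simpa using h0 1 ω⟩)
        rw [← h] at this ⊢
        exact this
      · refine le_of_forall_pos_le_add fun ε hε => ?_
        have h3 := key (max 0 (Γ - ε)) (le_max_left _ _)
          (hlow _ (max_lt h (by linarith)))
        have h4 : Γ - ε ≤ max 0 (Γ - ε) := le_max_right _ _
        nlinarith
    nlinarith
  have hP' : P A = 0 := (measureReal_eq_zero_iff).1 hP
  filter_upwards [measure_eq_zero_iff_ae_notMem.1 hP'] with ω hω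
  exact eventually_lt_of_notMem_upperSet hcc' hω

/-- The lower half of the pointwise ergodic theorem for functions with values in `[0, 1]`. -/
theorem ae_eventually_mul_le_sum [IsProbabilityMeasure P] (hT : Ergodic T P) {f : Ω → ℝ}
    (hf : Measurable f) (hf0 : ∀ ω, 0 ≤ f ω) (hf1 : ∀ ω, f ω ≤ 1) {η : ℝ}
    (hη : η < ∫ ω, f ω ∂P) :
    ∀ᵐ ω ∂P, ∀ᶠ n : ℕ in atTop, n * η ≤ ∑ i ∈ Finset.range n, f (T^[i] ω) := by
  -- Passing to `1 - f` keeps the summands nonnegative and turns the lower bound into an upper one.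
  -- By ergodicity the exceedance set is null or full, and full measure contradicts the mean.
  set X : ℕ → Ω → ℝ := fun n ω => ∑ i ∈ Finset.range n, (1 - f (T^[i] ω)) with hXdef
  have hT' := hT.toMeasurePreserving
  have hTi : ∀ i, Measurable (T^[i]) := fun i => (hT'.iterate i).measurable
  have hX : ∀ n, Measurable (X n) := fun n =>
    Finset.measurable_fun_sum _ fun i _ => measurable_const.sub (hf.comp (hTi i))
  have h0 : ∀ n ω, 0 ≤ X n ω := fun n ω =>
    Finset.sum_nonneg fun i _ => sub_nonneg.2 (hf1 _)
  have hs : ∀ m n ω, X m ω + X n (T^[m] ω) ≤ X (m + n) ω := by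
    intro m n ω
    simp only [hXdef, Finset.sum_range_add, ← Function.iterate_add_apply, add_comm]
    exact le_rfl
  have hfi : Integrable f P := Integrable.of_bound hf.aestronglyMeasurable 1
    (Eventually.of_forall fun ω => by rw [Real.norm_of_nonneg (hf0 ω)]; exact hf1 ω)
  have hfTi : ∀ i, Integrable (fun ω => f (T^[i] ω)) P := fun i =>
    (hT'.iterate i).integrable_comp_of_integrable hfi
  have hfI : ∀ i, ∫ ω, f (T^[i] ω) ∂P = ∫ ω, f ω ∂P := by
    intro i
    rw [← integral_map (hTi i).aemeasurable (f := f) hf.aestronglyMeasurable,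
      (hT'.iterate i).map_eq]
  have hXi : ∀ n, Integrable (X n) P := fun n =>
    integrable_finsetSum _ fun i _ => (integrable_const _).sub (hfTi i)
  have hΓ : ∀ n, ∫ ω, X n ω ∂P ≤ n * (1 - ∫ ω, f ω ∂P) := by
    intro n
    have hsub : ∀ i, Integrable (fun ω => 1 - f (T^[i] ω)) P :=
      fun i => (integrable_const _).sub (hfTi i)
    rw [integral_finsetSum _ fun i _ => hsub i]
    simp only [integral_sub (integrable_const (1 : ℝ)) (hfTi _), hfI]
    simp
    linarith
  obtain ⟨d, hd1, hd2⟩ := exists_between (sub_lt_sub_left hη 1)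
  set A := upperSet X d with hA
  have hAm : MeasurableSet A := measurableSet_upperSet hX d
  have hAT : T ⁻¹' A =ᵐ[P] A := ae_upperSet_iff hT' hX h0 hs d
  have hI1 : ∫ ω, f ω ∂P ≤ 1 := by
    calc ∫ ω, f ω ∂P ≤ ∫ _, (1 : ℝ) ∂P := integral_mono hfi (integrable_const _) hf1
      _ = 1 := by simp
  have hPA : P A = 0 := by
    rcases hT.quasiErgodic.ae_empty_or_univ₀ hAm.nullMeasurableSet hAT with h | h
    · rw [measure_congr h]; simp
    · exfalso
      have h1 := integral_le_of_exists_mul_le hT' hX hXi h0 hs hΓ (v := fun _ => d) (K := d)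
        measurable_const (fun ω => by linarith) (fun ω => le_rfl) (Eventually.of_forall fun ω => rfl)
        (by
          filter_upwards [h.mem_iff] with ω hω
          exact exists_mul_le_of_mem_upperSet (hω.2 trivial))
      simp at h1
      linarith
  filter_upwards [measure_eq_zero_iff_ae_notMem.1 hPA] with ω hω
  filter_upwards [eventually_lt_of_notMem_upperSet hd2 hω] with n hn
  simp only [hXdef, Finset.sum_sub_distrib, Finset.sum_const, Finset.card_range, nsmul_eq_mul,
    mul_one] at hn
  linarith

end Superadditive

/-! ### Deterministic properties of last-passage times -/

noncomputable section

namespace CornerGrowth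

/-- The array `w` seen from the point `(x, y)`. -/
def translate (x y : ℕ) (w : ℕ × ℕ → ℝ) : ℕ × ℕ → ℝ := fun ij => w (ij.1 + x, ij.2 + y)

theorem lastPassage_zero_left (w : ℕ × ℕ → ℝ) (n : ℕ) : lastPassage w 0 n = 0 := by
  rw [lastPassage]

theorem lastPassage_zero_right (w : ℕ × ℕ → ℝ) (m : ℕ) : lastPassage w m 0 = 0 := by
  cases m <;> rw [lastPassage]

theorem lastPassage_succ_succ (w : ℕ × ℕ → ℝ) (m n : ℕ) : lastPassage w (m + 1) (n + 1)
    = max (lastPassage w m (n + 1)) (lastPassage w (m + 1) n) + w (m, n) := by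
  rw [lastPassage]

/-- This locality is the source of independence for passage times of disjoint blocks. -/
theorem lastPassage_congr {w w' : ℕ × ℕ → ℝ} (m n : ℕ)
    (h : ∀ i < m, ∀ j < n, w (i, j) = w' (i, j)) : lastPassage w m n = lastPassage w' m n := by
  induction m generalizing n with
  | zero => simp [lastPassage_zero_left]
  | succ m ihm =>
    induction n with
    | zero => simp [lastPassage_zero_right]
    | succ n ihn =>
      rw [lastPassage_succ_succ, lastPassage_succ_succ,
        ihm (n + 1) fun i hi j hj => h i (by omega) j hj,
        ihn fun i hi j hj => h i hi j (by omega), h m (by omega) n (by omega)]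

theorem lastPassage_mono_weight {w w' : ℕ × ℕ → ℝ} (h : ∀ ij, w ij ≤ w' ij) (m n : ℕ) :
    lastPassage w m n ≤ lastPassage w' m n := by
  induction m generalizing n with
  | zero => simp [lastPassage_zero_left]
  | succ m ihm =>
    induction n with
    | zero => simp [lastPassage_zero_right]
    | succ n ihn =>
      rw [lastPassage_succ_succ, lastPassage_succ_succ]
      exact add_le_add (max_le_max (ihm _) ihn) (h _)

theorem lastPassage_const_mul {c : ℝ} (hc : 0 ≤ c) (w : ℕ × ℕ → ℝ) (m n : ℕ) :
    lastPassage (fun ij => c * w ij) m n = c * lastPassage w m n := by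
  induction m generalizing n with
  | zero => simp [lastPassage_zero_left]
  | succ m ihm =>
    induction n with
    | zero => simp [lastPassage_zero_right]
    | succ n ihn =>
      rw [lastPassage_succ_succ, lastPassage_succ_succ, ihm, ihn, mul_add, mul_max_of_nonneg _ _ hc]

theorem lastPassage_nonneg {w : ℕ × ℕ → ℝ} (h : ∀ ij, 0 ≤ w ij) (m n : ℕ) :
    0 ≤ lastPassage w m n := by
  induction m generalizing n with
  | zero => simp [lastPassage_zero_left]
  | succ m ihm =>
    cases n with
    | zero => simp [lastPassage_zero_right]
    | succ n =>
      rw [lastPassage_succ_succ]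
      exact add_nonneg ((ihm _).trans (le_max_left _ _)) (h _)

theorem lastPassage_mono {w : ℕ × ℕ → ℝ} (h : ∀ ij, 0 ≤ w ij) {m m' n n' : ℕ} (hm : m ≤ m')
    (hn : n ≤ n') : lastPassage w m n ≤ lastPassage w m' n' := by
  have h1 : ∀ n, Monotone fun m => lastPassage w m n := by
    intro n
    refine monotone_nat_of_le_succ fun m => ?_
    cases n with
    | zero => simp [lastPassage_zero_right]
    | succ n =>
      rw [lastPassage_succ_succ]
      exact (le_max_left _ _).trans (le_add_of_nonneg_right (h _))
  have h2 : ∀ m, Monotone fun n => lastPassage w m n := by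
    intro m
    refine monotone_nat_of_le_succ fun n => ?_
    cases m with
    | zero => simp [lastPassage_zero_left]
    | succ m =>
      rw [lastPassage_succ_succ]
      exact (le_max_right _ _).trans (le_add_of_nonneg_right (h _))
  exact (h1 n hm).trans (h2 m' hn)

/-- Concatenate an optimal path in the lower left rectangle with one in the translated rectangle. -/
theorem lastPassage_add_le {w : ℕ × ℕ → ℝ} (h : ∀ ij, 0 ≤ w ij) (x y m n : ℕ) :
    lastPassage w x y + lastPassage (translate x y w) m n ≤ lastPassage w (x + m) (y + n) := by
  induction m generalizing n with
  | zero =>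
    rw [lastPassage_zero_left, add_zero]
    exact lastPassage_mono h (by omega) (by omega)
  | succ m ihm =>
    induction n with
    | zero =>
      rw [lastPassage_zero_right, add_zero]
      exact lastPassage_mono h (by omega) (by omega)
    | succ n ihn =>
      have h1 := ihm (n + 1)
      rw [← add_assoc] at h1 ihn ⊢
      rw [← add_assoc, lastPassage_succ_succ, lastPassage_succ_succ, ← add_assoc, ← max_add_add_left]
      refine add_le_add (max_le_max h1 ihn) (le_of_eq ?_)
      simp [translate, add_comm]

/-- A path may cross the blocks of a diagonal chain one after another; `y` is the height, in blocks,
at which the chain starts. -/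
theorem sum_lastPassage_le {w : ℕ × ℕ → ℝ} (h : ∀ ij, 0 ≤ w ij) (y k l N : ℕ) :
    ∑ i ∈ Finset.range N, lastPassage (translate (i * k) ((i + y) * l) w) k l
      ≤ lastPassage w (N * k) ((N + y) * l) := by
  induction N with
  | zero => simpa using lastPassage_nonneg h _ _
  | succ N ih =>
    rw [Finset.sum_range_succ]
    have h1 := lastPassage_add_le h (N * k) ((N + y) * l) k l
    have e : (N + 1 + y) * l = (N + y) * l + l := by ring
    rw [add_one_mul, e]
    linarith

@[fun_prop]
theorem measurable_lastPassage (m n : ℕ) : Measurable fun w => lastPassage w m n := by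
  induction m generalizing n with
  | zero => simp [lastPassage_zero_left]
  | succ m ihm =>
    induction n with
    | zero => simp [lastPassage_zero_right]
    | succ n ihn =>
      simp only [lastPassage_succ_succ]
      exact ((ihm _).max ihn).add (measurable_pi_apply _)

/-! ### Coupling of the quenched measures -/

instance : IsProbabilityMeasure (expMeasure 1) := isProbabilityMeasure_expMeasure one_pos

/-- The law of an array of independent exponential variables with rate `1`. -/
def expArray : Measure (ℕ × ℕ → ℝ) := Measure.infinitePi fun _ => expMeasure 1

instance : IsProbabilityMeasure expArray := by unfold expArray; infer_instance

/-- The weights with parameters `p` obtained by rescaling the array `e`. -/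
def weight (p : PosSeq × PosSeq) (e : ℕ × ℕ → ℝ) : ℕ × ℕ → ℝ :=
  fun ij => |e ij| / ((p.1 ij.1 : ℝ) + (p.2 ij.2 : ℝ))

theorem rate_pos (p : PosSeq × PosSeq) (i j : ℕ) : 0 < (p.1 i : ℝ) + (p.2 j : ℝ) :=
  add_pos (p.1 i).2 (p.2 j).2

/-- The absolute value in `weight` matters only on a null set; it makes the path inequalities hold
at every point. -/
theorem weight_nonneg (p : PosSeq × PosSeq) (e : ℕ × ℕ → ℝ) (ij : ℕ × ℕ) : 0 ≤ weight p e ij :=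
  div_nonneg (abs_nonneg _) (rate_pos _ _ _).le

@[fun_prop]
theorem measurable_weight :
    Measurable fun x : (PosSeq × PosSeq) × (ℕ × ℕ → ℝ) => weight x.1 x.2 := by
  unfold weight
  fun_prop

@[fun_prop]
theorem measurable_weight_right (p : PosSeq × PosSeq) : Measurable (weight p) :=
  measurable_weight.comp (measurable_prodMk_left (x := p))

theorem ae_nonneg_expMeasure {r : ℝ} : ∀ᵐ x ∂(expMeasure r), 0 ≤ x := by
  rw [ae_iff]
  simp only [not_le]
  change expMeasure r (Set.Iio 0) = 0
  rw [expMeasure, gammaMeasure, withDensity_apply _ measurableSet_Iio]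
  exact lintegral_gammaPDF_of_nonpos le_rfl

theorem map_expMeasure_one {r : ℝ} (hr : 0 < r) :
    (expMeasure 1).map (fun x => |x| / r) = expMeasure r := by
  have h1 : (expMeasure 1).map (fun x => |x| / r) = (expMeasure 1).map (fun x => x / r) := by
    refine Measure.map_congr ?_
    filter_upwards [ae_nonneg_expMeasure] with x hx
    rw [abs_of_nonneg hx]
  have : IsProbabilityMeasure (expMeasure r) := isProbabilityMeasure_expMeasure hr
  have hm : Measurable fun x : ℝ => x / r := by fun_prop
  have := Measure.isProbabilityMeasure_map (μ := expMeasure 1) hm.aemeasurable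
  rw [h1]
  refine Measure.eq_of_cdf _ _ ?_
  ext x
  rw [cdf_expMeasure_eq hr, cdf_eq_real, map_measureReal_apply hm measurableSet_Iic]
  have h2 : (fun x : ℝ => x / r) ⁻¹' Set.Iic x = Set.Iic (r * x) := by
    ext y; simp [div_le_iff₀ hr, mul_comm]
  rw [h2, ← cdf_eq_real, cdf_expMeasure_eq one_pos]
  simp [mul_nonneg_iff_of_pos_left hr]

/-- Puts all quenched measures on one space, with randomness independent of `p`, so that shifting
parameters and array together preserves `μ.prod expArray`. -/
theorem map_weight (p : PosSeq × PosSeq) : expArray.map (weight p) = quenched p := by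
  unfold expArray quenched weight
  refine (Measure.infinitePi_map_pi (fun _ : ℕ × ℕ => expMeasure 1)
    (f := fun (ij : ℕ × ℕ) (x : ℝ) => |x| / ((p.1 ij.1 : ℝ) + (p.2 ij.2 : ℝ)))
    (by fun_prop)).trans ?_
  simp only [map_expMeasure_one (rate_pos _ _ _)]

/-- Translation of the parameters. -/
def shiftPair (k l : ℕ) : PosSeq × PosSeq → PosSeq × PosSeq := Prod.map (shift k) (shift l)

@[fun_prop]
theorem measurable_translate (x y : ℕ) : Measurable (translate x y) := by
  unfold translate; fun_prop

@[fun_prop]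
theorem measurable_shift (k : ℕ) : Measurable (shift k) := by
  unfold shift; fun_prop

@[fun_prop]
theorem measurable_shiftPair (k l : ℕ) : Measurable (shiftPair k l) := by
  unfold shiftPair; fun_prop

theorem measurePreserving_translate (x y : ℕ) :
    MeasurePreserving (translate x y) expArray expArray := by
  refine ⟨measurable_translate x y, ?_⟩
  unfold expArray translate
  exact Measure.map_infinitePi_infinitePi_of_inj (P := fun _ : ℕ × ℕ => expMeasure 1)
    (f := fun ij : ℕ × ℕ => (ij.1 + x, ij.2 + y))
    (fun a b h => by simpa [Prod.ext_iff] using h)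

theorem iterate_shiftPair (k l m : ℕ) : (shiftPair k l)^[m] = shiftPair (m * k) (m * l) := by
  induction m with
  | zero => ext p <;> simp [shiftPair, shift]
  | succ m ih =>
    rw [Function.iterate_succ', ih]
    ext p <;> simp [shiftPair, shift, add_mul, add_assoc, add_comm, add_left_comm]

theorem iterate_translate (k l m : ℕ) : (translate k l)^[m] = translate (m * k) (m * l) := by
  induction m with
  | zero => ext w; simp [translate]
  | succ m ih =>
    rw [Function.iterate_succ', ih]
    ext w; simp [translate, add_mul, add_assoc, add_comm, add_left_comm]

/-- The last-passage time of the weights with parameters `p` built from the array `e`. -/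
def passage (p : PosSeq × PosSeq) (e : ℕ × ℕ → ℝ) (m n : ℕ) : ℝ := lastPassage (weight p e) m n

theorem passage_nonneg (p : PosSeq × PosSeq) (e : ℕ × ℕ → ℝ) (m n : ℕ) : 0 ≤ passage p e m n :=
  lastPassage_nonneg (weight_nonneg p e) m n

@[fun_prop]
theorem measurable_passage (m n : ℕ) :
    Measurable fun x : (PosSeq × PosSeq) × (ℕ × ℕ → ℝ) => passage x.1 x.2 m n :=
  (measurable_lastPassage m n).comp measurable_weight

@[fun_prop]
theorem measurable_passage_right (p : PosSeq × PosSeq) (m n : ℕ) :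
    Measurable fun e : ℕ × ℕ → ℝ => passage p e m n :=
  (measurable_passage m n).comp (measurable_prodMk_left (x := p))

theorem quenched_lastPassage_le (p : PosSeq × PosSeq) (m n : ℕ) (x : ℝ) :
    quenched p {w | lastPassage w m n ≤ x} = expArray {e | passage p e m n ≤ x} := by
  rw [← map_weight, Measure.map_apply (measurable_weight_right p)
    (measurableSet_le (measurable_lastPassage m n) measurable_const)]
  rfl

/-! ### Independent blocks and Chernoff's bound -/

/-- The variables `e` in the `k × l` block with lower left corner `(b.1 * k, b.2 * l)`. -/
def block (k l : ℕ) (b : ℕ × ℕ) (e : ℕ × ℕ → ℝ) : Fin k × Fin l → ℝ :=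
  fun c => e (b.1 * k + c.1, b.2 * l + c.2)

/-- Extension of a `k × l` array by zero. -/
def extendZero {k l : ℕ} (v : Fin k × Fin l → ℝ) : ℕ × ℕ → ℝ :=
  fun ij => if h : ij.1 < k ∧ ij.2 < l then v (⟨ij.1, h.1⟩, ⟨ij.2, h.2⟩) else 0

theorem measurable_extendZero (k l : ℕ) : Measurable (extendZero (k := k) (l := l)) := by
  refine measurable_pi_lambda _ fun ij => ?_
  unfold extendZero
  split_ifs with h
  · exact measurable_pi_apply _
  · exact measurable_const

theorem mul_add_fin_inj {k a b : ℕ} {c d : Fin k} (h : a * k + c = b * k + d) :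
    a = b ∧ c = d := by
  have hk : 0 < k := c.pos
  have h1 := congrArg (· / k) h
  have h2 := congrArg (· % k) h
  simp only [mul_comm _ k, Nat.mul_add_div hk, Nat.mul_add_mod, Nat.div_eq_of_lt c.2,
    Nat.div_eq_of_lt d.2, Nat.mod_eq_of_lt c.2, Nat.mod_eq_of_lt d.2, add_zero] at h1 h2
  exact ⟨h1, Fin.ext h2⟩

/-- Division with remainder makes (block, position) ↦ site injective, so the reindexed array is
again a product measure; currying it exhibits the joint law of the blocks as a product. -/
theorem iIndepFun_block (k l : ℕ) : iIndepFun (block k l) expArray := by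
  have hb : ∀ b, Measurable (block k l b) := fun b => by unfold block; fun_prop
  have hinj : Function.Injective fun x : (ℕ × ℕ) × (Fin k × Fin l) =>
      (x.1.1 * k + (x.2.1 : ℕ), x.1.2 * l + (x.2.2 : ℕ)) := by
    rintro ⟨⟨a, b⟩, c, d⟩ ⟨⟨a', b'⟩, c', d'⟩ h
    simp only [Prod.mk.injEq] at h ⊢
    exact ⟨⟨(mul_add_fin_inj h.1).1, (mul_add_fin_inj h.2).1⟩,
      (mul_add_fin_inj h.1).2, (mul_add_fin_inj h.2).2⟩
  have hmap : ∀ b, expArray.map (block k l b) = Measure.infinitePi fun _ => expMeasure 1 := by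
    intro b
    refine Measure.map_infinitePi_infinitePi_of_inj (P := fun _ : ℕ × ℕ => expMeasure 1)
      (f := fun c : Fin k × Fin l => (b.1 * k + (c.1 : ℕ), b.2 * l + (c.2 : ℕ))) ?_
    intro c c' h
    have := @hinj (b, c) (b, c') h
    simpa using this
  rw [iIndepFun_iff_map_fun_eq_infinitePi_map hb]
  simp only [hmap]
  rw [← Measure.infinitePi_map_curry (fun (_ : ℕ × ℕ) (_ : Fin k × Fin l) => expMeasure 1),
    ← Measure.map_infinitePi_infinitePi_of_inj (P := fun _ : ℕ × ℕ => expMeasure 1) hinj,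
    Measure.map_map (by fun_prop) (by fun_prop)]
  rfl

theorem iIndepFun_passage_block (p : PosSeq × PosSeq) (k l : ℕ) :
    iIndepFun (fun (b : ℕ × ℕ) e => passage (shiftPair (b.1 * k) (b.2 * l) p)
      (translate (b.1 * k) (b.2 * l) e) k l) expArray := by
  have h := (iIndepFun_block k l).comp
    (fun b v => passage (shiftPair (b.1 * k) (b.2 * l) p) (extendZero v) k l)
    (fun b => (measurable_passage_right _ _ _).comp (measurable_extendZero k l))
  convert h using 3 with b e
  refine lastPassage_congr _ _ fun i hi j hj => ?_
  simp [weight, extendZero, block, translate, hi, hj, add_comm]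

/-- One minus the Laplace transform of the quenched last-passage time to `(k, l)`. -/
def laplaceGap (θ : ℝ) (k l : ℕ) (p : PosSeq × PosSeq) : ℝ :=
  1 - ∫ e, Real.exp (-θ * passage p e k l) ∂expArray

theorem exp_passage_le_one {θ : ℝ} (hθ : 0 ≤ θ) (p : PosSeq × PosSeq) (e : ℕ × ℕ → ℝ) (k l : ℕ) :
    Real.exp (-θ * passage p e k l) ≤ 1 :=
  Real.exp_le_one_iff.2 (by nlinarith [passage_nonneg p e k l])

theorem integrable_exp_passage {θ : ℝ} (hθ : 0 ≤ θ) (p : PosSeq × PosSeq) (k l : ℕ) :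
    Integrable (fun e => Real.exp (-θ * passage p e k l)) expArray :=
  Integrable.of_bound (by fun_prop) 1 (Eventually.of_forall fun e => by
    rw [Real.norm_of_nonneg (Real.exp_pos _).le]
    exact exp_passage_le_one hθ p e k l)

theorem laplaceGap_nonneg {θ : ℝ} (hθ : 0 ≤ θ) (k l : ℕ) (p : PosSeq × PosSeq) :
    0 ≤ laplaceGap θ k l p := by
  have : ∫ e, Real.exp (-θ * passage p e k l) ∂expArray ≤ ∫ _, (1 : ℝ) ∂expArray :=
    integral_mono (integrable_exp_passage hθ p k l) (integrable_const _)
      fun e => exp_passage_le_one hθ p e k l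
  simp at this
  simpa [laplaceGap] using this

theorem laplaceGap_le_one (θ : ℝ) (k l : ℕ) (p : PosSeq × PosSeq) : laplaceGap θ k l p ≤ 1 := by
  have : 0 ≤ ∫ e, Real.exp (-θ * passage p e k l) ∂expArray :=
    integral_nonneg fun e => (Real.exp_pos _).le
  unfold laplaceGap
  linarith

theorem measurable_laplaceGap (θ : ℝ) (k l : ℕ) : Measurable (laplaceGap θ k l) := by
  have h : StronglyMeasurable fun x : (PosSeq × PosSeq) × (ℕ × ℕ → ℝ) =>
      Real.exp (-θ * passage x.1 x.2 k l) := by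
    apply Measurable.stronglyMeasurable
    fun_prop
  exact measurable_const.sub h.integral_prod_right.measurable

theorem integral_laplaceGap (μ : Measure (PosSeq × PosSeq)) [IsProbabilityMeasure μ] {θ : ℝ}
    (hθ : 0 ≤ θ) (k l : ℕ) : ∫ p, laplaceGap θ k l p ∂μ
      = ∫ x, (1 - Real.exp (-θ * passage x.1 x.2 k l)) ∂(μ.prod expArray) := by
  have h : Integrable (fun x : (PosSeq × PosSeq) × (ℕ × ℕ → ℝ) =>
      Real.exp (-θ * passage x.1 x.2 k l)) (μ.prod expArray) :=
    Integrable.of_bound (by fun_prop) 1 (Eventually.of_forall fun e => by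
      rw [Real.norm_of_nonneg (Real.exp_pos _).le]
      exact exp_passage_le_one hθ _ _ k l)
  have h' : Integrable (fun x : (PosSeq × PosSeq) × (ℕ × ℕ → ℝ) =>
      1 - Real.exp (-θ * passage x.1 x.2 k l)) (μ.prod expArray) := (integrable_const _).sub h
  rw [integral_prod _ h']
  refine integral_congr_ae (Eventually.of_forall fun p => ?_)
  simp only [laplaceGap]
  rw [integral_sub (integrable_const _) (integrable_exp_passage hθ p k l)]
  simp

/-- Translation invariance of `expArray` makes the left side `1 - laplaceGap`, and `1 - x ≤ exp
(-x)`. -/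
theorem mgf_passage_block_le (p : PosSeq × PosSeq) (θ : ℝ) (k l x y : ℕ) :
    mgf (fun e => passage (shiftPair x y p) (translate x y e) k l) expArray (-θ)
      ≤ Real.exp (-laplaceGap θ k l (shiftPair x y p)) := by
  have h : mgf (fun e => passage (shiftPair x y p) (translate x y e) k l) expArray (-θ)
      = 1 - laplaceGap θ k l (shiftPair x y p) := by
    unfold mgf laplaceGap
    rw [sub_sub_cancel]
    have h1 := integral_map (μ := expArray) (φ := translate x y)
      (f := fun e => Real.exp (-θ * passage (shiftPair x y p) e k l))
      (measurable_translate x y).aemeasurable (by fun_prop)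
    rw [(measurePreserving_translate x y).map_eq] at h1
    exact h1.symm
  rw [h]
  linarith [Real.add_one_le_exp (-laplaceGap θ k l (shiftPair x y p))]

/-- Chernoff's bound for the sums of the passage times of independent blocks along `L` parallel
diagonals of length `N`. -/
theorem passage_le_prob_le (p : PosSeq × PosSeq) {θ : ℝ} (hθ : 0 ≤ θ) (k l N L : ℕ) (x : ℝ) :
    expArray.real {e | passage p e (N * k) ((N + L) * l) ≤ x}
      ≤ Real.exp (∑ j ∈ Finset.range L, (θ * x - ∑ i ∈ Finset.range N,
          laplaceGap θ k l (shiftPair (i * k) ((i + j) * l) p))) := by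
  -- `b.1` labels the diagonal and `b.2` the position on it; distinct labels give distinct blocks.
  set B : ℕ × ℕ → (ℕ × ℕ → ℝ) → ℝ := fun b e => passage (shiftPair (b.2 * k) ((b.2 + b.1) * l) p)
      (translate (b.2 * k) ((b.2 + b.1) * l) e) k l with hB
  have hBm : ∀ b, Measurable (B b) := fun b => by rw [hB]; fun_prop
  have hind : iIndepFun B expArray := (iIndepFun_passage_block p k l).precomp
    (g := fun b : ℕ × ℕ => (b.2, b.2 + b.1)) (fun a b h => by
      simp only [Prod.mk.injEq] at h
      ext <;> omega)
  set s := Finset.range L ×ˢ Finset.range N with hs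
  have hB0 : ∀ b e, 0 ≤ B b e := fun b e => passage_nonneg _ _ _ _
  -- Each of the `L` chains stays inside the rectangle, so each sum is at most `x`.
  have hsub : {e | passage p e (N * k) ((N + L) * l) ≤ x} ⊆ {e | (∑ b ∈ s, B b) e ≤ L * x} := by
    intro e he
    simp only [Set.mem_ofPred_eq, Finset.sum_apply, hs, Finset.sum_product] at he ⊢
    calc ∑ j ∈ Finset.range L, ∑ i ∈ Finset.range N, B (j, i) e
        ≤ ∑ j ∈ Finset.range L, x := Finset.sum_le_sum fun j hj => ?_
      _ = L * x := by simp
    refine le_trans (sum_lastPassage_le (weight_nonneg p e) j k l N) (le_trans ?_ he)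
    exact lastPassage_mono (weight_nonneg p e) le_rfl
      (Nat.mul_le_mul_right _ (by have := Finset.mem_range.1 hj; omega))
  have hint : Integrable (fun e => Real.exp (-θ * (∑ b ∈ s, B b) e)) expArray := by
    refine Integrable.of_bound ?_ 1 (Eventually.of_forall fun e => ?_)
    · simp only [Finset.sum_apply]
      fun_prop
    · rw [Real.norm_of_nonneg (Real.exp_pos _).le, Finset.sum_apply]
      exact Real.exp_le_one_iff.2
        (by nlinarith [Finset.sum_nonneg (s := s) fun b _ => hB0 b e])
  calc expArray.real {e | passage p e (N * k) ((N + L) * l) ≤ x}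
      ≤ expArray.real {e | (∑ b ∈ s, B b) e ≤ L * x} := measureReal_mono hsub
    _ ≤ Real.exp (-(-θ) * (L * x)) * mgf (∑ b ∈ s, B b) expArray (-θ) :=
        measure_le_le_exp_mul_mgf _ (by linarith) hint
    _ = Real.exp (θ * (L * x)) * ∏ b ∈ s, mgf (B b) expArray (-θ) := by
        rw [hind.mgf_sum hBm, neg_neg]
    _ ≤ Real.exp (θ * (L * x)) * ∏ b ∈ s,
          Real.exp (-laplaceGap θ k l (shiftPair (b.2 * k) ((b.2 + b.1) * l) p)) := by
        refine mul_le_mul_of_nonneg_left ?_ (Real.exp_pos _).le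
        exact Finset.prod_le_prod (fun b _ => mgf_nonneg) fun b _ => mgf_passage_block_le p θ k l _ _
    _ = _ := by
        rw [← Real.exp_sum, ← Real.exp_add, hs, Finset.sum_product]
        simp only [Finset.sum_sub_distrib, Finset.sum_neg_distrib, Finset.sum_const,
          Finset.card_range, nsmul_eq_mul]
        rw [mul_left_comm, sub_eq_add_neg]

/-! ### Moment bounds for passage times -/

theorem lintegral_exp_expMeasure_one :
    ∫⁻ x, ENNReal.ofReal (Real.exp (|x| / 2)) ∂(expMeasure 1) = 2 := by
  have hm : Measurable (gammaPDF 1 1) := (measurable_gammaPDFReal 1 1).ennreal_ofReal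
  rw [expMeasure, gammaMeasure, lintegral_withDensity_eq_lintegral_mul _ hm (by fun_prop)]
  have h : ∀ x, (gammaPDF 1 1 * fun x => ENNReal.ofReal (Real.exp (|x| / 2))) x
      = 2 * exponentialPDF (1 / 2) x := by
    intro x
    change exponentialPDF 1 x * ENNReal.ofReal (Real.exp (|x| / 2)) = _
    rcases lt_or_ge x 0 with hx | hx
    · simp [exponentialPDF_of_neg hx]
    · rw [exponentialPDF_of_nonneg hx, exponentialPDF_of_nonneg hx,
        ← ENNReal.ofReal_mul (by positivity), ← ENNReal.ofReal_ofNat,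
        ← ENNReal.ofReal_mul (by positivity), abs_of_nonneg hx, mul_assoc, ← Real.exp_add]
      congr 1
      ring_nf
  simp only [h]
  rw [lintegral_const_mul' _ _ (by simp), lintegral_exponentialPDF_eq_one (by norm_num), mul_one]

/-- By `h` the site `(m, n)` lies outside the `a × b` rectangle, so the two factors are independent.
-/
theorem lintegral_lastPassage_mul (m n a b : ℕ) (h : a ≤ m ∨ b ≤ n) :
    ∫⁻ e, ENNReal.ofReal (Real.exp (lastPassage (fun ij => |e ij|) a b / 2))
        * ENNReal.ofReal (Real.exp (|e (m, n)| / 2)) ∂expArray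
      = 2 * ∫⁻ e, ENNReal.ofReal (Real.exp (lastPassage (fun ij => |e ij|) a b / 2)) ∂expArray := by
  have hmeas : Measurable fun e : ℕ × ℕ → ℝ =>
      ENNReal.ofReal (Real.exp (lastPassage (fun ij => |e ij|) a b / 2)) := by
    have := (measurable_lastPassage a b).comp
      (g := fun w => lastPassage w a b) (f := fun (e : ℕ × ℕ → ℝ) ij => |e ij|) (by fun_prop)
    exact (Real.measurable_exp.comp (this.div_const 2)).ennreal_ofReal
  have hmeas' : Measurable fun e : ℕ × ℕ → ℝ => ENNReal.ofReal (Real.exp (|e (m, n)| / 2)) := by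
    fun_prop
  have hind0 : iIndepFun (fun (ij : ℕ × ℕ) (e : ℕ × ℕ → ℝ) => e ij) expArray :=
    iIndepFun_infinitePi (X := fun _ x => x) (by fun_prop)
  have hind1 := hind0.indepFun_finset (Finset.range a ×ˢ Finset.range b) {(m, n)}
    (by simp; omega) (by fun_prop)
  set ext : ((Finset.range a ×ˢ Finset.range b : Finset (ℕ × ℕ)) → ℝ) → ℕ × ℕ → ℝ :=
    fun v ij => if h : ij ∈ Finset.range a ×ˢ Finset.range b then v ⟨ij, h⟩ else 0 with hext
  have hextm : Measurable ext := by
    refine measurable_pi_lambda _ fun ij => ?_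
    rw [hext]
    dsimp only
    split_ifs with h
    · exact measurable_pi_apply _
    · exact measurable_const
  have hind := hind1.comp (φ := fun v =>
      ENNReal.ofReal (Real.exp (lastPassage (fun ij => |ext v ij|) a b / 2)))
    (ψ := fun v : ({(m, n)} : Finset (ℕ × ℕ)) → ℝ =>
      ENNReal.ofReal (Real.exp (|v ⟨(m, n), Finset.mem_singleton_self _⟩| / 2)))
    (hmeas.comp hextm) (by fun_prop)
  have e1 : (fun v => ENNReal.ofReal (Real.exp (lastPassage (fun ij => |ext v ij|) a b / 2)))
      ∘ (fun (e : ℕ × ℕ → ℝ) (i : (Finset.range a ×ˢ Finset.range b : Finset (ℕ × ℕ))) => e i)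
      = fun e => ENNReal.ofReal (Real.exp (lastPassage (fun ij => |e ij|) a b / 2)) := by
    ext e
    simp only [Function.comp]
    rw [lastPassage_congr (w' := fun ij => |e ij|)]
    intro i hi j hj
    simp [hext, hi, hj]
  rw [e1] at hind
  have h2 := lintegral_mul_eq_lintegral_mul_lintegral_of_indepFun hmeas hmeas' hind
  have h3 : ∫⁻ e, ENNReal.ofReal (Real.exp (|e (m, n)| / 2)) ∂expArray = 2 := by
    rw [← lintegral_exp_expMeasure_one]
    exact ((measurePreserving_eval_infinitePi (fun _ : ℕ × ℕ => expMeasure 1) (m, n)).lintegral_comp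
      (f := fun x => ENNReal.ofReal (Real.exp (|x| / 2))) (by fun_prop))
  rw [h3, mul_comm _ (2 : ENNReal)] at h2
  exact h2

/-- Bound the exponential of the maximum by the sum of the exponentials: each recursion step has two
terms, each with a factor `2` from the new weight. -/
theorem lintegral_exp_lastPassage_le (m n : ℕ) :
    ∫⁻ e, ENNReal.ofReal (Real.exp (lastPassage (fun ij => |e ij|) m n / 2)) ∂expArray
      ≤ 4 ^ (m + n) := by
  induction m generalizing n with
  | zero => simpa [lastPassage_zero_left] using one_le_pow₀ (by norm_num)
  | succ m ihm =>
    induction n with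
    | zero => simpa [lastPassage_zero_right] using one_le_pow₀ (by norm_num)
    | succ n ihn =>
      have hmeas : ∀ a b, Measurable fun e : ℕ × ℕ → ℝ =>
          ENNReal.ofReal (Real.exp (lastPassage (fun ij => |e ij|) a b / 2)) := by
        intro a b
        have := (measurable_lastPassage a b).comp
          (g := fun w => lastPassage w a b) (f := fun (e : ℕ × ℕ → ℝ) ij => |e ij|) (by fun_prop)
        exact (Real.measurable_exp.comp (this.div_const 2)).ennreal_ofReal
      have h1 : ∀ e : ℕ × ℕ → ℝ,
          ENNReal.ofReal (Real.exp (lastPassage (fun ij => |e ij|) (m + 1) (n + 1) / 2))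
          ≤ ENNReal.ofReal (Real.exp (lastPassage (fun ij => |e ij|) m (n + 1) / 2))
              * ENNReal.ofReal (Real.exp (|e (m, n)| / 2))
            + ENNReal.ofReal (Real.exp (lastPassage (fun ij => |e ij|) (m + 1) n / 2))
              * ENNReal.ofReal (Real.exp (|e (m, n)| / 2)) := by
        intro e
        rw [lastPassage_succ_succ, ← add_mul, ← ENNReal.ofReal_add (by positivity) (by positivity),
          ← ENNReal.ofReal_mul (by positivity), add_div, Real.exp_add]
        refine ENNReal.ofReal_le_ofReal (mul_le_mul_of_nonneg_right ?_ (Real.exp_pos _).le)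
        rcases max_cases (lastPassage (fun ij => |e ij|) m (n + 1))
          (lastPassage (fun ij => |e ij|) (m + 1) n) with h | h <;> rw [h.1]
        · linarith [Real.exp_pos (lastPassage (fun ij => |e ij|) (m + 1) n / 2)]
        · linarith [Real.exp_pos (lastPassage (fun ij => |e ij|) m (n + 1) / 2)]
      refine (lintegral_mono h1).trans ?_
      have hprod : Measurable fun e : ℕ × ℕ → ℝ =>
          ENNReal.ofReal (Real.exp (lastPassage (fun ij => |e ij|) m (n + 1) / 2))
            * ENNReal.ofReal (Real.exp (|e (m, n)| / 2)) := (hmeas m (n + 1)).mul (by fun_prop)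
      rw [lintegral_add_left hprod,
        lintegral_lastPassage_mul _ _ _ _ (Or.inl le_rfl),
        lintegral_lastPassage_mul _ _ _ _ (Or.inr le_rfl)]
      have h4 : (4 : ENNReal) ^ (m + 1 + (n + 1))
          = 2 * 4 ^ (m + (n + 1)) + 2 * 4 ^ (m + 1 + n) := by
        rw [show m + 1 + (n + 1) = (m + n + 1) + 1 by ring, show m + (n + 1) = m + n + 1 by ring,
          show m + 1 + n = m + n + 1 by ring, pow_succ, ← add_mul, mul_comm]
        norm_num
      rw [h4]
      exact add_le_add (mul_le_mul_right (ihm _) _) (mul_le_mul_right ihn _)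

/-- With `u = G / 2` and `v = (m + n) log 4`, integrate `u ≤ v + exp (u - v)`; the exponential has
mean at most `1`. -/
theorem lintegral_lastPassage_le (m n : ℕ) :
    ∫⁻ e, ENNReal.ofReal (lastPassage (fun ij => |e ij|) m n) ∂expArray
      ≤ ENNReal.ofReal (2 * ((m + n) * Real.log 4 + 1)) := by
  have hlog : 0 ≤ Real.log 4 := Real.log_nonneg (by norm_num)
  have hv : 0 ≤ (m + n) * Real.log 4 := mul_nonneg (by positivity) hlog
  have h1 : ∀ e : ℕ × ℕ → ℝ, ENNReal.ofReal (lastPassage (fun ij => |e ij|) m n)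
      ≤ ENNReal.ofReal (2 * ((m + n) * Real.log 4)) + ENNReal.ofReal (2 * ((4 : ℝ) ^ (m + n))⁻¹)
        * ENNReal.ofReal (Real.exp (lastPassage (fun ij => |e ij|) m n / 2)) := by
    intro e
    rw [← ENNReal.ofReal_mul (by positivity), ← ENNReal.ofReal_add (by positivity) (by positivity)]
    refine ENNReal.ofReal_le_ofReal ?_
    obtain ⟨u, hu⟩ : ∃ u, u = lastPassage (fun ij => |e ij|) m n / 2 := ⟨_, rfl⟩
    have h2 := Real.add_one_le_exp (u - (m + n) * Real.log 4)
    have h3 : Real.exp ((m + n) * Real.log 4) = 4 ^ (m + n) := by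
      rw [← Nat.cast_add, mul_comm, Real.exp_mul, Real.exp_log (by norm_num), Real.rpow_natCast]
    rw [Real.exp_sub, h3, div_eq_inv_mul] at h2
    rw [← hu]
    linarith
  refine (lintegral_mono h1).trans ?_
  rw [lintegral_add_left measurable_const, lintegral_const_mul' _ _ ENNReal.ofReal_ne_top,
    mul_add, ENNReal.ofReal_add (by positivity) (by positivity)]
  simp only [lintegral_const, measure_univ, mul_one]
  refine add_le_add le_rfl ((mul_le_mul_right (lintegral_exp_lastPassage_le m n) _).trans ?_)
  rw [show (4 : ENNReal) ^ (m + n) = ENNReal.ofReal (4 ^ (m + n)) by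
    rw [ENNReal.ofReal_pow (by norm_num)]; norm_num, ← ENNReal.ofReal_mul (by positivity)]
  refine ENNReal.ofReal_le_ofReal (le_of_eq ?_)
  rw [mul_assoc, inv_mul_cancel₀ (by positivity), mul_one]

/-! ### Stationarity of the parameters and mean passage times -/

variable {μ : Measure (PosSeq × PosSeq)}

/-- Covers `k = 0` or `l = 0`, where no hypothesis applies directly: `μ` is its own image under the
shift by `(1, 1)`, and a further shift by `(k, l)` has both steps positive in total. -/
theorem measurePreserving_shiftPair
    (hE : ∀ k l : ℕ, 0 < k → 0 < l → Ergodic (shiftPair k l) μ) (k l : ℕ) :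
    MeasurePreserving (shiftPair k l) μ μ := by
  refine ⟨measurable_shiftPair k l, ?_⟩
  have h1 := (hE 1 1 one_pos one_pos).toMeasurePreserving.map_eq
  have h2 := (hE (k + 1) (l + 1) k.succ_pos l.succ_pos).toMeasurePreserving.map_eq
  have h3 : shiftPair k l ∘ shiftPair 1 1 = shiftPair (k + 1) (l + 1) := by
    ext p i <;> simp [shiftPair, shift, add_assoc]
  conv_lhs => rw [← h1]
  rw [Measure.map_map (by fun_prop) (by fun_prop), h3, h2]

theorem measurePreserving_prodMap [IsProbabilityMeasure μ]
    (hE : ∀ k l : ℕ, 0 < k → 0 < l → Ergodic (shiftPair k l) μ) (k l : ℕ) :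
    MeasurePreserving (Prod.map (shiftPair k l) (translate k l)) (μ.prod expArray)
      (μ.prod expArray) :=
  (measurePreserving_shiftPair hE k l).prod (measurePreserving_translate k l)

theorem ae_le_rate (hE : ∀ k l : ℕ, 0 < k → 0 < l → Ergodic (shiftPair k l) μ) :
    ∀ᵐ p ∂μ, ∀ i j : ℕ, essInf (fun p : PosSeq × PosSeq => (p.1 0 : ℝ)) μ
      + essInf (fun p : PosSeq × PosSeq => (p.2 0 : ℝ)) μ ≤ (p.1 i : ℝ) + (p.2 j : ℝ) := by
  have h1 : ∀ᵐ p ∂μ, essInf (fun p : PosSeq × PosSeq => (p.1 0 : ℝ)) μ ≤ (p.1 0 : ℝ) :=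
    ae_essInf_le (isBoundedUnder_of ⟨0, fun p => (p.1 0).2.le⟩)
  have h2 : ∀ᵐ p ∂μ, essInf (fun p : PosSeq × PosSeq => (p.2 0 : ℝ)) μ ≤ (p.2 0 : ℝ) :=
    ae_essInf_le (isBoundedUnder_of ⟨0, fun p => (p.2 0).2.le⟩)
  rw [ae_all_iff]
  intro i
  rw [ae_all_iff]
  intro j
  filter_upwards [(measurePreserving_shiftPair hE i j).quasiMeasurePreserving.ae h1,
    (measurePreserving_shiftPair hE i j).quasiMeasurePreserving.ae h2] with p hp1 hp2
  simp only [shiftPair, shift, Prod.map_fst, Prod.map_snd, zero_add] at hp1 hp2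
  exact add_le_add hp1 hp2

/-- The mean of the last-passage time to `(m, n)`, averaged also over the parameters. -/
def meanPassage (μ : Measure (PosSeq × PosSeq)) (m n : ℕ) : ℝ :=
  ∫ x, passage x.1 x.2 m n ∂(μ.prod expArray)

theorem meanPassage_nonneg (m n : ℕ) : 0 ≤ meanPassage μ m n :=
  integral_nonneg fun _ => passage_nonneg _ _ _ _

theorem lintegral_passage_le [IsProbabilityMeasure μ] {c : ℝ} (hc : 0 < c)
    (h : ∀ᵐ p ∂μ, ∀ i j : ℕ, c ≤ (p.1 i : ℝ) + (p.2 j : ℝ)) (m n : ℕ) :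
    ∫⁻ x, ENNReal.ofReal (passage x.1 x.2 m n) ∂(μ.prod expArray)
      ≤ ENNReal.ofReal (c⁻¹ * (2 * ((m + n) * Real.log 4 + 1))) := by
  rw [lintegral_prod _ (by fun_prop)]
  calc ∫⁻ p, ∫⁻ e, ENNReal.ofReal (passage p e m n) ∂expArray ∂μ
      ≤ ∫⁻ _, ENNReal.ofReal (c⁻¹ * (2 * ((m + n) * Real.log 4 + 1))) ∂μ := ?_
    _ = _ := by simp
  refine lintegral_mono_ae ?_
  filter_upwards [h] with p hp
  calc ∫⁻ e, ENNReal.ofReal (passage p e m n) ∂expArray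
      ≤ ∫⁻ e, ENNReal.ofReal c⁻¹ * ENNReal.ofReal (lastPassage (fun ij => |e ij|) m n)
          ∂expArray := lintegral_mono fun e => ?_
    _ = ENNReal.ofReal c⁻¹ * ∫⁻ e, ENNReal.ofReal (lastPassage (fun ij => |e ij|) m n)
          ∂expArray := lintegral_const_mul' _ _ ENNReal.ofReal_ne_top
    _ ≤ _ := by
      rw [ENNReal.ofReal_mul (by positivity)]
      exact mul_le_mul_right (lintegral_lastPassage_le m n) _
  rw [← ENNReal.ofReal_mul (by positivity), ← lastPassage_const_mul (by positivity)]
  refine ENNReal.ofReal_le_ofReal (lastPassage_mono_weight (fun ij => ?_) m n)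
  rw [weight, div_eq_inv_mul]
  exact mul_le_mul_of_nonneg_right (inv_anti₀ hc (hp _ _)) (abs_nonneg _)

theorem integrable_passage [IsProbabilityMeasure μ] {c : ℝ} (hc : 0 < c)
    (h : ∀ᵐ p ∂μ, ∀ i j : ℕ, c ≤ (p.1 i : ℝ) + (p.2 j : ℝ)) (m n : ℕ) :
    Integrable (fun x => passage x.1 x.2 m n) (μ.prod expArray) := by
  refine ⟨by fun_prop, ?_⟩
  rw [hasFiniteIntegral_iff_ofReal (Eventually.of_forall fun _ => passage_nonneg _ _ _ _)]
  exact (lintegral_passage_le hc h m n).trans_lt ENNReal.ofReal_lt_top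

theorem meanPassage_le [IsProbabilityMeasure μ] {c : ℝ} (hc : 0 < c)
    (h : ∀ᵐ p ∂μ, ∀ i j : ℕ, c ≤ (p.1 i : ℝ) + (p.2 j : ℝ)) (m n : ℕ) :
    meanPassage μ m n ≤ c⁻¹ * (2 * ((m + n) * Real.log 4 + 1)) := by
  have hlog : 0 ≤ Real.log 4 := Real.log_nonneg (by norm_num)
  rw [meanPassage, integral_eq_lintegral_of_nonneg_ae
    (Eventually.of_forall fun _ => passage_nonneg _ _ _ _) (by fun_prop)]
  exact ENNReal.toReal_le_of_le_ofReal (by positivity) (lintegral_passage_le hc h m n)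

theorem meanPassage_mono [IsProbabilityMeasure μ] {c : ℝ} (hc : 0 < c)
    (h : ∀ᵐ p ∂μ, ∀ i j : ℕ, c ≤ (p.1 i : ℝ) + (p.2 j : ℝ)) {m m' n n' : ℕ} (hm : m ≤ m')
    (hn : n ≤ n') : meanPassage μ m n ≤ meanPassage μ m' n' :=
  integral_mono (integrable_passage hc h m n) (integrable_passage hc h m' n')
    fun x => lastPassage_mono (weight_nonneg x.1 x.2) hm hn

/-- The shape function. -/
def shape (μ : Measure (PosSeq × PosSeq)) (s t : ℝ) : ℝ :=
  ⨆ q : ℕ, meanPassage μ ⌊(q : ℝ) * s⌋₊ ⌊(q : ℝ) * t⌋₊ / q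

/-- Without this bound the real supremum in `shape` would be a default value. The term `q = 0` is
`0`. -/
theorem bddAbove_shape [IsProbabilityMeasure μ] {c : ℝ} (hc : 0 < c)
    (h : ∀ᵐ p ∂μ, ∀ i j : ℕ, c ≤ (p.1 i : ℝ) + (p.2 j : ℝ)) {s t : ℝ} (hs : 0 ≤ s) (ht : 0 ≤ t) :
    BddAbove (Set.range fun q : ℕ => meanPassage μ ⌊(q : ℝ) * s⌋₊ ⌊(q : ℝ) * t⌋₊ / q) := by
  have hlog : 0 ≤ Real.log 4 := Real.log_nonneg (by norm_num)
  refine ⟨c⁻¹ * (2 * ((s + t) * Real.log 4 + 1)), ?_⟩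
  rintro _ ⟨q, rfl⟩
  dsimp only
  rcases Nat.eq_zero_or_pos q with rfl | hq
  · simp; positivity
  · have hq1 : (1 : ℝ) ≤ q := by exact_mod_cast hq
    rw [div_le_iff₀ (by linarith)]
    refine (meanPassage_le hc h _ _).trans ?_
    have h1 := Nat.floor_le (a := (q : ℝ) * s) (by positivity)
    have h2 := Nat.floor_le (a := (q : ℝ) * t) (by positivity)
    rw [mul_assoc c⁻¹, mul_assoc 2]
    refine mul_le_mul_of_nonneg_left (mul_le_mul_of_nonneg_left ?_ (by norm_num)) (by positivity)
    nlinarith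

theorem meanPassage_le_shape [IsProbabilityMeasure μ] {c : ℝ} (hc : 0 < c)
    (h : ∀ᵐ p ∂μ, ∀ i j : ℕ, c ≤ (p.1 i : ℝ) + (p.2 j : ℝ)) {s t : ℝ} (hs : 0 ≤ s) (ht : 0 ≤ t)
    (q : ℕ) : meanPassage μ ⌊(q : ℝ) * s⌋₊ ⌊(q : ℝ) * t⌋₊ ≤ q * shape μ s t := by
  rcases Nat.eq_zero_or_pos q with rfl | hq
  · simp [meanPassage, passage, lastPassage_zero_left]
  · have := le_ciSup (bddAbove_shape hc h hs ht) q
    rw [div_le_iff₀ (by exact_mod_cast hq)] at this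
    exact this.trans_eq (mul_comm _ _)

theorem shape_nonneg (s t : ℝ) : 0 ≤ shape μ s t :=
  Real.iSup_nonneg fun _ => div_nonneg (meanPassage_nonneg _ _) (Nat.cast_nonneg _)

/-- For large `u` the mean of `1 - exp (-G / u)` is close to the mean of `G / u`. -/
theorem exists_lt_mul_integral_laplaceGap [IsProbabilityMeasure μ] {c : ℝ} (hc : 0 < c)
    (h : ∀ᵐ p ∂μ, ∀ i j : ℕ, c ≤ (p.1 i : ℝ) + (p.2 j : ℝ)) {k l : ℕ} {x : ℝ}
    (hx : x < meanPassage μ k l) :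
    ∃ u : ℕ, 0 < u ∧ x < u * ∫ p, laplaceGap (1 / (u : ℝ)) k l p ∂μ := by
  -- This is `z / (1 + z) ≤ 1 - exp (-z) ≤ z` for `z = y / u`; it provides both the limit and the
  -- dominating function `passage`.
  have bound : ∀ (u : ℕ) (y : ℝ), 0 < u → 0 ≤ y →
      y * (1 + y * (1 / (u : ℝ)))⁻¹ ≤ u * (1 - Real.exp (-(1 / (u : ℝ)) * y)) ∧
      u * (1 - Real.exp (-(1 / (u : ℝ)) * y)) ≤ y := by
    intro u y hu hy
    have hu' : (0 : ℝ) < u := by exact_mod_cast hu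
    obtain ⟨z, hz⟩ : ∃ z, z = y * (1 / (u : ℝ)) := ⟨_, rfl⟩
    have hz0 : 0 ≤ z := by rw [hz]; positivity
    have hyz : y = u * z := by rw [hz]; field_simp
    have e1 : -(1 / (u : ℝ)) * y = -z := by rw [hz]; ring
    rw [e1, ← hz, hyz, mul_assoc]
    constructor
    · refine mul_le_mul_of_nonneg_left ?_ hu'.le
      have h1 := Real.add_one_le_exp z
      have h2 : Real.exp (-z) ≤ (1 + z)⁻¹ := by
        rw [Real.exp_neg]
        exact inv_anti₀ (by linarith) (by linarith)
      have h3 : z * (1 + z)⁻¹ = 1 - (1 + z)⁻¹ := by field_simp; ring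
      linarith
    · refine mul_le_mul_of_nonneg_left ?_ hu'.le
      linarith [Real.add_one_le_exp (-z)]
  have hlim : Tendsto (fun u : ℕ => ∫ x, (u : ℝ) * (1 - Real.exp (-(1 / (u : ℝ))
      * passage x.1 x.2 k l)) ∂(μ.prod expArray)) atTop (𝓝 (meanPassage μ k l)) := by
    refine tendsto_integral_filter_of_dominated_convergence (fun x => passage x.1 x.2 k l)
      (Eventually.of_forall fun u => by fun_prop) ?_ (integrable_passage hc h k l) ?_
    · filter_upwards [eventually_gt_atTop 0] with u hu
      refine Eventually.of_forall fun x => ?_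
      have h0 := passage_nonneg x.1 x.2 k l
      have h1 := bound u _ hu h0
      rw [Real.norm_of_nonneg (le_trans (by positivity) h1.1)]
      exact h1.2
    · refine Eventually.of_forall fun x => ?_
      have h0 := passage_nonneg x.1 x.2 k l
      have h1 : Tendsto (fun u : ℕ => passage x.1 x.2 k l
          * (1 + passage x.1 x.2 k l * (1 / (u : ℝ)))⁻¹) atTop
          (𝓝 (passage x.1 x.2 k l * (1 + passage x.1 x.2 k l * 0)⁻¹)) :=
        (((tendsto_one_div_atTop_nhds_zero_nat.const_mul _).const_add _).inv₀ (by simp)).const_mul _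
      simp only [mul_zero, add_zero, inv_one, mul_one] at h1
      refine tendsto_of_tendsto_of_tendsto_of_le_of_le' h1 tendsto_const_nhds ?_ ?_
      · filter_upwards [eventually_gt_atTop 0] with u hu using (bound u _ hu h0).1
      · filter_upwards [eventually_gt_atTop 0] with u hu using (bound u _ hu h0).2
  obtain ⟨u, h1, h2⟩ := ((hlim.eventually_const_lt hx).and (eventually_gt_atTop 0)).exists
  refine ⟨u, h2, ?_⟩
  rw [integral_laplaceGap μ (by positivity), ← integral_const_mul]
  exact h1

/-- All quantifiers range over countable sets, so one null set will serve all real `s`, `t`, `r`.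
The start height `j * l` is removed by stationarity. -/
theorem ae_forall_eventually_le_sum_laplaceGap [IsProbabilityMeasure μ]
    (hE : ∀ k l : ℕ, 0 < k → 0 < l → Ergodic (shiftPair k l) μ) :
    ∀ᵐ p ∂μ, ∀ k l u j : ℕ, 0 < k → 0 < l → ∀ η : ℚ,
      (η : ℝ) < ∫ p, laplaceGap (1 / (u : ℝ)) k l p ∂μ → ∀ᶠ N : ℕ in atTop,
        N * (η : ℝ) ≤ ∑ i ∈ Finset.range N,
          laplaceGap (1 / (u : ℝ)) k l (shiftPair (i * k) ((i + j) * l) p) := by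
  simp only [ae_all_iff]
  intro k l u j hk hl η hη
  have h1 := Superadditive.ae_eventually_mul_le_sum (hE k l hk hl) (measurable_laplaceGap _ k l)
    (laplaceGap_nonneg (by positivity) k l) (laplaceGap_le_one (1 / (u : ℝ)) k l) hη
  filter_upwards [(measurePreserving_shiftPair hE 0 (j * l)).quasiMeasurePreserving.ae h1]
    with p hp
  refine hp.mono fun N hN => hN.trans (le_of_eq (Finset.sum_congr rfl fun i _ => ?_))
  congr 1
  rw [iterate_shiftPair]
  ext n <;> simp [shiftPair, shift, add_mul, add_assoc]

/-! ### The lower tail -/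

theorem div_mul_floor_le {s : ℝ} (hs : 0 ≤ s) (n q : ℕ) :
    n / q * ⌊(q : ℝ) * s⌋₊ ≤ ⌊(n : ℝ) * s⌋₊ := by
  refine Nat.le_floor ?_
  push_cast
  have h1 : ((n / q : ℕ) : ℝ) * q ≤ n := by exact_mod_cast Nat.div_mul_le_self n q
  have h2 := Nat.floor_le (a := (q : ℝ) * s) (by positivity)
  calc ((n / q : ℕ) : ℝ) * ⌊(q : ℝ) * s⌋₊ ≤ (n / q : ℕ) * (q * s) :=
        mul_le_mul_of_nonneg_left h2 (Nat.cast_nonneg _)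
    _ = ((n / q : ℕ) * q) * s := by ring
    _ ≤ n * s := mul_le_mul_of_nonneg_right h1 hs

/-- The lower tail probabilities decay faster than every exponential. -/
theorem ae_exists_lower_tail_le [IsProbabilityMeasure μ]
    (hE : ∀ k l : ℕ, 0 < k → 0 < l → Ergodic (shiftPair k l) μ) {c : ℝ} (hc : 0 < c)
    (h : ∀ᵐ p ∂μ, ∀ i j : ℕ, c ≤ (p.1 i : ℝ) + (p.2 j : ℝ)) :
    ∀ᵐ p ∂μ, ∀ s t r : ℝ, 0 < s → 0 < t → r < shape μ s t → ∃ δ : ℝ, 0 < δ ∧ ∀ L : ℕ,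
      ∀ᶠ n : ℕ in atTop, expArray.real {e | passage p e ⌊(n : ℝ) * s⌋₊ ⌊(n : ℝ) * t⌋₊ ≤ n * r}
        ≤ Real.exp (-(L * δ * n)) := by
  filter_upwards [ae_forall_eventually_le_sum_laplaceGap hE] with p hp s t r hs ht hr
  rcases lt_or_ge r 0 with hr0 | hr0
  · refine ⟨1, one_pos, fun L => ?_⟩
    filter_upwards [eventually_gt_atTop 0] with n hn
    have hn' : (0 : ℝ) < n := by exact_mod_cast hn
    have : {e | passage p e ⌊(n : ℝ) * s⌋₊ ⌊(n : ℝ) * t⌋₊ ≤ n * r} = ∅ := by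
      ext e
      simp only [Set.mem_ofPred_eq, Set.mem_empty_iff_false, iff_false, not_le]
      exact (mul_neg_of_pos_of_neg hn' hr0).trans_le (passage_nonneg _ _ _ _)
    rw [this]
    simp [Real.exp_nonneg]
  obtain ⟨q, hq⟩ := exists_lt_of_lt_ciSup hr
  -- The default value of division by zero makes the term `q = 0` vanish, and `r ≥ 0` excludes it.
  have hq0 : 0 < q := by
    rcases Nat.eq_zero_or_pos q with rfl | hq0
    · simp at hq; linarith
    · exact hq0
  have hq0' : (0 : ℝ) < q := by exact_mod_cast hq0
  set k := ⌊(q : ℝ) * s⌋₊ with hk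
  set l := ⌊(q : ℝ) * t⌋₊ with hl
  rw [lt_div_iff₀ hq0'] at hq
  have hmean : 0 < meanPassage μ k l := lt_of_le_of_lt (by positivity) hq
  have hk0 : 0 < k := Nat.pos_of_ne_zero fun h0 => by
    rw [h0] at hmean
    simp [meanPassage, passage, lastPassage_zero_left] at hmean
  have hl0 : 0 < l := Nat.pos_of_ne_zero fun h0 => by
    rw [h0] at hmean
    simp [meanPassage, passage, lastPassage_zero_right] at hmean
  obtain ⟨u, hu, hux⟩ := exists_lt_mul_integral_laplaceGap hc h hq
  have hu' : (0 : ℝ) < u := by exact_mod_cast hu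
  replace hux := (div_lt_iff₀' hu').2 hux
  obtain ⟨η, hη1, hη2⟩ := exists_rat_btwn hux
  have hη0 : (0 : ℝ) < η := lt_of_le_of_lt (by positivity) hη1
  -- Per unit of `n`, one diagonal gains `η / q` and pays `r / u`. Half of the difference is kept to
  -- absorb rounding.
  set δ : ℝ := (η / q - r / u) / 2 with hδ
  have hδ0 : 0 < δ := by
    have : r / u < η / q := by
      rw [lt_div_iff₀ hq0']
      calc r / u * q = r * q / u := by ring
        _ < η := hη1
    rw [hδ]; linarith
  refine ⟨δ, hδ0, fun L => ?_⟩
  have hev1 : ∀ᶠ N : ℕ in atTop, ∀ j ∈ Finset.range L, N * (η : ℝ) ≤ ∑ i ∈ Finset.range N,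
      laplaceGap (1 / (u : ℝ)) k l (shiftPair (i * k) ((i + j) * l) p) :=
    (eventually_all_finset _).2 fun j _ => hp k l u j hk0 hl0 η hη2
  have hN : Tendsto (fun n : ℕ => n / q - L) atTop atTop :=
    (tendsto_sub_atTop_nat L).comp (Nat.tendsto_div_const_atTop hq0.ne')
  -- At most `1 + L` blocks are lost: one by rounding `n / q`, and `L` to leave room for the shifted
  -- diagonals.
  have hev3 : ∀ᶠ n : ℕ in atTop, (1 + L) * (η : ℝ) ≤ n * δ :=
    ((tendsto_natCast_atTop_atTop (R := ℝ)).atTop_mul_const hδ0).eventually_ge_atTop _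
  filter_upwards [hN.eventually hev1, eventually_ge_atTop (L * q), hev3] with n h1 h2 h3
  have hLn : L ≤ n / q := (Nat.le_div_iff_mul_le hq0).2 h2
  set N := n / q - L with hNdef
  have hNL : N + L = n / q := by omega
  have hsub : {e | passage p e ⌊(n : ℝ) * s⌋₊ ⌊(n : ℝ) * t⌋₊ ≤ n * r}
      ⊆ {e | passage p e (N * k) ((N + L) * l) ≤ n * r} := by
    intro e he
    refine le_trans (lastPassage_mono (weight_nonneg p e) ?_ ?_) he
    · exact (Nat.mul_le_mul_right _ (by omega)).trans (div_mul_floor_le hs.le n q)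
    · rw [hNL]; exact div_mul_floor_le ht.le n q
  refine (measureReal_mono hsub).trans
    ((passage_le_prob_le p (θ := 1 / (u : ℝ)) (by positivity) k l N L _).trans ?_)
  refine Real.exp_le_exp.2 ?_
  have hNn : (n : ℝ) / q - 1 - L ≤ N := by
    have h5 : (n : ℝ) / q < (n / q : ℕ) + 1 := by
      rw [div_lt_iff₀ hq0']
      exact_mod_cast Nat.lt_mul_of_div_lt (Nat.lt_succ_self _) hq0
    have h6 : ((n / q : ℕ) : ℝ) = N + L := by exact_mod_cast hNL.symm
    linarith
  calc ∑ j ∈ Finset.range L, (1 / (u : ℝ) * (n * r) - ∑ i ∈ Finset.range N,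
        laplaceGap (1 / (u : ℝ)) k l (shiftPair (i * k) ((i + j) * l) p))
      ≤ ∑ j ∈ Finset.range L, (-(δ * n)) := Finset.sum_le_sum fun j hj => ?_
    _ = -(L * δ * n) := by simp; ring
  have h7 := h1 j hj
  have h8 : ((n : ℝ) / q - 1 - L) * η ≤ N * η := mul_le_mul_of_nonneg_right hNn hη0.le
  have h9 : δ * n = (n / q * η - 1 / u * (n * r)) / 2 := by rw [hδ]; ring
  nlinarith

/-! ### Identification of the shape function -/

theorem ae_eventually_lt_passage [IsProbabilityMeasure μ]
    (hE : ∀ k l : ℕ, 0 < k → 0 < l → Ergodic (shiftPair k l) μ) {c : ℝ} (hc : 0 < c)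
    (h : ∀ᵐ p ∂μ, ∀ i j : ℕ, c ≤ (p.1 i : ℝ) + (p.2 j : ℝ)) :
    ∀ᵐ p ∂μ, ∀ s t r : ℝ, 0 < s → 0 < t → r < shape μ s t → ∀ᵐ e ∂expArray,
      ∀ᶠ n : ℕ in atTop, n * r < passage p e ⌊(n : ℝ) * s⌋₊ ⌊(n : ℝ) * t⌋₊ := by
  filter_upwards [ae_exists_lower_tail_le hE hc h] with p hp s t r hs ht hr
  obtain ⟨δ, hδ, hL⟩ := hp s t r hs ht hr
  have h1 := hL 1
  simp only [Nat.cast_one, one_mul] at h1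
  have hsum : Summable fun n : ℕ => Real.exp (-(δ * n)) := by
    have := Real.summable_exp_nat_mul_iff.2 (neg_lt_zero.2 hδ)
    simpa [mul_comm] using this
  have hsum' : Summable fun n : ℕ =>
      expArray.real {e | passage p e ⌊(n : ℝ) * s⌋₊ ⌊(n : ℝ) * t⌋₊ ≤ n * r} := by
    refine Summable.of_norm_bounded_eventually_nat hsum (h1.mono fun n hn => ?_)
    rwa [Real.norm_of_nonneg measureReal_nonneg]
  have h2 := hsum'.tsum_ofReal_ne_top
  simp only [Measure.real, ENNReal.ofReal_toReal (measure_ne_top expArray _)] at h2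
  filter_upwards [ae_eventually_notMem h2] with e he
  exact he.mono fun n hn => not_le.1 hn

/-- Along an integer direction the passage times are superadditive for the joint shift, and
`ae_eventually_lt_passage` supplies the lower growth rate required by
`Superadditive.ae_eventually_lt`. -/
theorem ae_eventually_passage_mul_lt [IsProbabilityMeasure μ]
    (hE : ∀ k l : ℕ, 0 < k → 0 < l → Ergodic (shiftPair k l) μ) {c : ℝ} (hc : 0 < c)
    (h : ∀ᵐ p ∂μ, ∀ i j : ℕ, c ≤ (p.1 i : ℝ) + (p.2 j : ℝ)) {k l : ℕ} (hk : 0 < k) (hl : 0 < l)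
    {c' : ℝ} (hc' : shape μ k l < c') :
    ∀ᵐ p ∂μ, ∀ᵐ e ∂expArray, ∀ᶠ n : ℕ in atTop, passage p e (n * k) (n * l) < n * c' := by
  have hfloor : ∀ n m : ℕ, ⌊(n : ℝ) * (m : ℝ)⌋₊ = n * m := fun n m => by
    rw [← Nat.cast_mul, Nat.floor_natCast]
  have hiter : ∀ n, (Prod.map (shiftPair k l) (translate k l))^[n]
      = Prod.map (shiftPair (n * k) (n * l)) (translate (n * k) (n * l)) := fun n => by
    rw [Prod.map_iterate, iterate_shiftPair, iterate_translate]
  refine Measure.ae_ae_of_ae_prod (p := fun x : (PosSeq × PosSeq) × (ℕ × ℕ → ℝ) =>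
    ∀ᶠ n : ℕ in atTop, passage x.1 x.2 (n * k) (n * l) < n * c') ?_
  refine Superadditive.ae_eventually_lt (T := Prod.map (shiftPair k l) (translate k l))
    (X := fun n x => passage x.1 x.2 (n * k) (n * l)) (Γ := shape μ k l)
    (measurePreserving_prodMap hE k l) (fun n => by fun_prop)
    (fun n => integrable_passage hc h _ _) (fun n x => passage_nonneg _ _ _ _) ?_
    (shape_nonneg _ _) ?_ ?_ hc'
  · intro m n x
    rw [hiter, add_mul, add_mul]
    exact lastPassage_add_le (weight_nonneg x.1 x.2) (m * k) (m * l) (n * k) (n * l)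
  · intro n
    have := meanPassage_le_shape hc h (Nat.cast_nonneg k) (Nat.cast_nonneg l) n
    rwa [hfloor, hfloor] at this
  · intro r hr
    rw [Measure.ae_prod_iff_ae_ae]
    · filter_upwards [ae_eventually_lt_passage hE hc h] with p hp
      filter_upwards [hp k l r (by exact_mod_cast hk) (by exact_mod_cast hl) hr] with e he
      obtain ⟨n, h1, h2⟩ := (he.and (eventually_gt_atTop 0)).exists
      rw [hfloor, hfloor] at h1
      exact ⟨n, h2, h1.le⟩
    · have : {x : (PosSeq × PosSeq) × (ℕ × ℕ → ℝ) | ∃ n : ℕ, 0 < n ∧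
          n * r ≤ passage x.1 x.2 (n * k) (n * l)} = ⋃ n : ℕ, ⋃ (_ : 0 < n),
          {x | n * r ≤ passage x.1 x.2 (n * k) (n * l)} := by
        ext x; simp
      rw [this]
      exact MeasurableSet.iUnion fun n => MeasurableSet.iUnion fun _ =>
        measurableSet_le measurable_const (measurable_passage _ _)

/-- The rectangle of scale `m` in direction `(k, l)` fits into that of scale `m * q` in direction
`(s, t)`. -/
theorem shape_natCast_le [IsProbabilityMeasure μ] {c : ℝ} (hc : 0 < c)
    (h : ∀ᵐ p ∂μ, ∀ i j : ℕ, c ≤ (p.1 i : ℝ) + (p.2 j : ℝ)) {s t : ℝ} (hs : 0 ≤ s) (ht : 0 ≤ t)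
    {k l q : ℕ} (hk : k ≤ q * s) (hl : l ≤ q * t) : shape μ k l ≤ q * shape μ s t := by
  refine ciSup_le fun m => ?_
  rcases Nat.eq_zero_or_pos m with rfl | hm
  · simpa using mul_nonneg (Nat.cast_nonneg q) (shape_nonneg s t)
  rw [div_le_iff₀ (by exact_mod_cast hm)]
  have h1 := meanPassage_le_shape hc h hs ht (m * q)
  have h2 : ∀ {a : ℕ} {x : ℝ}, a ≤ q * x → ⌊(m : ℝ) * a⌋₊ ≤ ⌊((m * q : ℕ) : ℝ) * x⌋₊ := by
    intro a x hx
    refine Nat.floor_mono ?_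
    push_cast
    rw [mul_assoc]
    exact mul_le_mul_of_nonneg_left hx (Nat.cast_nonneg _)
  refine (meanPassage_mono hc h (h2 hk) (h2 hl)).trans (h1.trans (le_of_eq ?_))
  push_cast
  ring

theorem ae_eventually_passage_lt [IsProbabilityMeasure μ]
    (hE : ∀ k l : ℕ, 0 < k → 0 < l → Ergodic (shiftPair k l) μ) {c : ℝ} (hc : 0 < c)
    (h : ∀ᵐ p ∂μ, ∀ i j : ℕ, c ≤ (p.1 i : ℝ) + (p.2 j : ℝ)) {s t : ℝ} (hs : 0 < s) (ht : 0 < t)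
    {r : ℝ} (hr : shape μ s t < r) :
    ∀ᵐ p ∂μ, ∀ᵐ e ∂expArray, ∀ᶠ n : ℕ in atTop,
      passage p e ⌊(n : ℝ) * s⌋₊ ⌊(n : ℝ) * t⌋₊ < n * r := by
  -- `d` makes the rounded-up direction `(k, l)` fit at scale `q + d`; `q` is then so large that `(q
  -- + d) * shape μ s t < q * r`.
  obtain ⟨d, hd⟩ := exists_nat_ge (max s⁻¹ t⁻¹)
  have hds : 1 ≤ d * s := by
    rw [← inv_mul_cancel₀ hs.ne']
    exact mul_le_mul_of_nonneg_right ((le_max_left _ _).trans hd) hs.le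
  have hdt : 1 ≤ d * t := by
    rw [← inv_mul_cancel₀ ht.ne']
    exact mul_le_mul_of_nonneg_right ((le_max_right _ _).trans hd) ht.le
  obtain ⟨q, hq⟩ := exists_nat_gt (d * shape μ s t / (r - shape μ s t))
  have hrs : 0 < r - shape μ s t := sub_pos.2 hr
  have hq0' : (0 : ℝ) < q :=
    lt_of_le_of_lt (div_nonneg (mul_nonneg (Nat.cast_nonneg _) (shape_nonneg _ _)) hrs.le) hq
  have hq0 : 0 < q := by exact_mod_cast hq0'
  rw [div_lt_iff₀ hrs] at hq
  set k := ⌊(q : ℝ) * s⌋₊ + 1 with hk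
  set l := ⌊(q : ℝ) * t⌋₊ + 1 with hl
  have hkq : (k : ℝ) ≤ (q + d : ℕ) * s := by
    rw [hk]; push_cast
    linarith [Nat.floor_le (a := (q : ℝ) * s) (by positivity)]
  have hlq : (l : ℝ) ≤ (q + d : ℕ) * t := by
    rw [hl]; push_cast
    linarith [Nat.floor_le (a := (q : ℝ) * t) (by positivity)]
  have hshape := shape_natCast_le hc h hs.le ht.le hkq hlq
  obtain ⟨c', hc1, hc2⟩ : ∃ c', shape μ k l < c' ∧ c' < q * r := by
    refine exists_between (hshape.trans_lt ?_)
    push_cast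
    linarith
  have hc'0 : 0 < c' := (shape_nonneg _ _).trans_lt hc1
  filter_upwards [ae_eventually_passage_mul_lt hE hc h (k := k) (l := l) (by omega) (by omega) hc1]
    with p hp
  filter_upwards [hp] with e he
  -- Here `n / q` is rounded up, so that the multiple of `(k, l)` dominates `(⌊n s⌋, ⌊n t⌋)`.
  have hN : Tendsto (fun n : ℕ => n / q + 1) atTop atTop :=
    (tendsto_add_atTop_nat 1).comp (Nat.tendsto_div_const_atTop hq0.ne')
  have hpos : 0 < r - c' / q := by
    rw [sub_pos, div_lt_iff₀ hq0', mul_comm]; exact hc2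
  have hev : ∀ᶠ n : ℕ in atTop, c' ≤ n * (r - c' / q) :=
    ((tendsto_natCast_atTop_atTop (R := ℝ)).atTop_mul_const hpos).eventually_ge_atTop _
  filter_upwards [hN.eventually he, hev] with n h1 h2
  have hnq : (n : ℝ) ≤ (n / q + 1 : ℕ) * q := by
    exact_mod_cast (Nat.lt_mul_of_div_lt (Nat.lt_succ_self _) hq0).le
  have hfl : ∀ x : ℝ, 0 < x → ⌊(n : ℝ) * x⌋₊ ≤ (n / q + 1) * (⌊(q : ℝ) * x⌋₊ + 1) := by
    intro x hx
    refine Nat.floor_le_of_le ?_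
    rw [Nat.cast_mul]
    have h4 := Nat.lt_floor_add_one ((q : ℝ) * x)
    calc (n : ℝ) * x ≤ ((n / q + 1 : ℕ) * q) * x := mul_le_mul_of_nonneg_right hnq hx.le
      _ = (n / q + 1 : ℕ) * (q * x) := by ring
      _ ≤ _ := by
        refine mul_le_mul_of_nonneg_left ?_ (Nat.cast_nonneg _)
        push_cast
        exact h4.le
  have hdiv : ((n / q + 1 : ℕ) : ℝ) ≤ n / q + 1 := by
    push_cast
    linarith [Nat.cast_div_le (α := ℝ) (m := n) (n := q)]
  calc passage p e ⌊(n : ℝ) * s⌋₊ ⌊(n : ℝ) * t⌋₊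
      ≤ passage p e ((n / q + 1) * k) ((n / q + 1) * l) :=
        lastPassage_mono (weight_nonneg p e) (hfl s hs) (hfl t ht)
    _ < (n / q + 1 : ℕ) * c' := h1
    _ ≤ (n / q + 1) * c' := mul_le_mul_of_nonneg_right hdiv hc'0.le
    _ = n * (c' / q) + c' := by ring
    _ ≤ n * r := by linarith

theorem isShapeFunction_shape [IsProbabilityMeasure μ]
    (hE : ∀ k l : ℕ, 0 < k → 0 < l → Ergodic (shiftPair k l) μ) {c : ℝ} (hc : 0 < c)
    (h : ∀ᵐ p ∂μ, ∀ i j : ℕ, c ≤ (p.1 i : ℝ) + (p.2 j : ℝ)) :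
    IsShapeFunction μ (shape μ) := by
  intro s t hs ht
  have hup : ∀ᵐ p ∂μ, ∀ r : ℚ, shape μ s t < r → ∀ᵐ e ∂expArray, ∀ᶠ n : ℕ in atTop,
      passage p e ⌊(n : ℝ) * s⌋₊ ⌊(n : ℝ) * t⌋₊ < n * r := by
    simp only [ae_all_iff]
    exact fun r hr => ae_eventually_passage_lt hE hc h hs ht hr
  filter_upwards [hup, ae_eventually_lt_passage hE hc h] with p hp1 hp2
  rw [← map_weight, ae_map_iff (measurable_weight_right p).aemeasurable
    (measurableSet_tendsto _ fun n => (measurable_lastPassage _ _).div_const _)]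
  have h1 : ∀ᵐ e ∂expArray, ∀ r : ℚ, shape μ s t < r → ∀ᶠ n : ℕ in atTop,
      passage p e ⌊(n : ℝ) * s⌋₊ ⌊(n : ℝ) * t⌋₊ < n * r := by
    simpa only [ae_all_iff] using hp1
  have h2 : ∀ᵐ e ∂expArray, ∀ r : ℚ, (r : ℝ) < shape μ s t → ∀ᶠ n : ℕ in atTop,
      n * (r : ℝ) < passage p e ⌊(n : ℝ) * s⌋₊ ⌊(n : ℝ) * t⌋₊ := by
    simp only [ae_all_iff]
    exact fun r hr => hp2 s t r hs ht hr
  filter_upwards [h1, h2] with e he1 he2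
  refine tendsto_order.2 ⟨fun a ha => ?_, fun a ha => ?_⟩
  · obtain ⟨r, hr1, hr2⟩ := exists_rat_btwn ha
    filter_upwards [he2 r hr2, eventually_gt_atTop 0] with n hn hn0
    refine hr1.trans ?_
    rw [lt_div_iff₀ (by exact_mod_cast hn0)]
    exact (mul_comm _ _).trans_lt hn
  · obtain ⟨r, hr1, hr2⟩ := exists_rat_btwn ha
    filter_upwards [he1 r hr1, eventually_gt_atTop 0] with n hn hn0
    refine lt_trans ?_ hr2
    rw [div_lt_iff₀ (by exact_mod_cast hn0)]
    exact hn.trans_eq (mul_comm _ _)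

end CornerGrowth

end

/-! ### The theorem -/

theorem mainTheorem8
    (μ : Measure (CornerGrowth.PosSeq × CornerGrowth.PosSeq)) [IsProbabilityMeasure μ]
    (h_ergodic : ∀ k l : ℕ, 0 < k → 0 < l →
      Ergodic (Prod.map (CornerGrowth.shift k) (CornerGrowth.shift l)) μ)
    (h_integrable : Integrable
      (fun p : CornerGrowth.PosSeq × CornerGrowth.PosSeq => (p.1 0 : ℝ) + (p.2 0 : ℝ)) μ)
    (h_essInf : 0 <
      essInf (fun p : CornerGrowth.PosSeq × CornerGrowth.PosSeq => (p.1 0 : ℝ)) μ +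
        essInf (fun p : CornerGrowth.PosSeq × CornerGrowth.PosSeq => (p.2 0 : ℝ)) μ) :
    ∃ g : ℝ → ℝ → ℝ, CornerGrowth.IsShapeFunction μ g ∧
      ∀ᵐ p ∂μ, ∀ s t r : ℝ, 0 < s → 0 < t → r < g s t →
        Tendsto
          (fun n : ℕ => -(((1 / (n : ℝ) : ℝ) : EReal) *
            ENNReal.log (CornerGrowth.quenched p
              {w | CornerGrowth.lastPassage w ⌊(n : ℝ) * s⌋₊ ⌊(n : ℝ) * t⌋₊ ≤ (n : ℝ) * r})))
          atTop (𝓝 (⊤ : EReal)) := by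
  have hE : ∀ k l : ℕ, 0 < k → 0 < l → Ergodic (CornerGrowth.shiftPair k l) μ := h_ergodic
  have hrate := CornerGrowth.ae_le_rate hE
  refine ⟨CornerGrowth.shape μ, CornerGrowth.isShapeFunction_shape hE h_essInf hrate, ?_⟩
  filter_upwards [CornerGrowth.ae_exists_lower_tail_le hE h_essInf hrate] with p hp s t r hs ht hr
  obtain ⟨δ, hδ, hL⟩ := hp s t r hs ht hr
  rw [EReal.tendsto_nhds_top_iff_real]
  intro x
  -- Since `δ` does not depend on `L`, enough diagonals make the rate `L * δ` exceed any prescribed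
  -- `x`.
  obtain ⟨L, hLx⟩ := exists_nat_gt (x / δ)
  rw [div_lt_iff₀ hδ] at hLx
  filter_upwards [hL L, eventually_gt_atTop 0] with n hn hn0
  have hn0' : (0 : ℝ) < n := by exact_mod_cast hn0
  rw [CornerGrowth.quenched_lastPassage_le]
  have h1 : CornerGrowth.expArray {e | CornerGrowth.passage p e ⌊(n : ℝ) * s⌋₊ ⌊(n : ℝ) * t⌋₊
      ≤ (n : ℝ) * r} ≤ ENNReal.ofReal (Real.exp (-(L * δ * n))) := by
    rw [← ofReal_measureReal]
    exact ENNReal.ofReal_le_ofReal hn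
  have h2 := ENNReal.log_le_log h1
  rw [ENNReal.log_ofReal_of_pos (Real.exp_pos _), Real.log_exp] at h2
  have h3 : ((1 / (n : ℝ) : ℝ) : EReal) * ENNReal.log (CornerGrowth.expArray
      {e | CornerGrowth.passage p e ⌊(n : ℝ) * s⌋₊ ⌊(n : ℝ) * t⌋₊ ≤ (n : ℝ) * r})
      ≤ ((-(L * δ) : ℝ) : EReal) := by
    refine (mul_le_mul_of_nonneg_left h2 (by exact_mod_cast (by positivity))).trans (le_of_eq ?_)
    rw [← EReal.coe_mul]
    congr 1
    field_simp
  calc (x : EReal) < ((L * δ : ℝ) : EReal) := by exact_mod_cast hLx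
    _ = -((-(L * δ) : ℝ) : EReal) := by rw [← EReal.coe_neg, neg_neg]
    _ ≤ _ := EReal.neg_le_neg_iff.2 h3
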